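/- Let $p$ be a prime, $ku_*=\mathbb Z_{(p)}[v]$, $g_k=p^k-1$, and $a_k=\binom{p^2}{k+1}v^k$ for $0\le k\le p^2-1$ (the coefficients of the $[p^2]$-series $\sum_k a_kx^{k+1}$). Let $ku_*(\mathbb Z_{p^2})$ be the $ku_*$-module with generators $e_j$ $(j\ge1)$ and relations $\sum_{k=0}^{p^2-1}a_ke_{j-k}=0$ $(j\ge 1)$, where $e_h=0$ for $h\le0$; let $F=\bigoplus_{i\ge1}ku_*\,\alpha_i$, $\alpha_h=0$ for $h\le0$, and write $[i,j]=\alpha_i\otimes e_j\in F\otimes_{ku_*}ku_*(\mathbb Z_{p^2})$, so that $[i,j]=0$ if $i\le0$ or $j\le0$. Consider the chain complex $$\cdots\to0\to F\otimes_{ku_*}ku_*(\mathbb Z_{p^2})\xrightarrow{\ \partial_2\ }F\otimes_{ku_*}ku_*(\mathbb Z_{p^2})\to0\to\cdots,\qquad \partial_2[i,j]=\sum_{k=0}^{p^2-1}a_k[i-k,j],$$ filtered (in both degrees) by letting the part of filtration $\le s$ be the $ku_*$-submodule spanned by the $[i,j]$ with $i,j\ge1$ and $|[i,j]|:=i(p^2+1)+j(p+1)\le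 s$. Let $(E^r,d_r)_{r\ge0}$ be the associated spectral sequence, so that $d_r$ lowers the filtration by $r$ and goes from the source part (homological degree $1$) to the target part (homological degree $0$). Put $$\mu_1=g_2,\qquad \mu_2=g_1(p^2+1)+g_2(p+1).$$ **Theorem.** There are exactly two families of nonzero differentials: $d_r=0$ for $r\ne\mu_1,\mu_2$, and there are units $u_1,u_2$ of $ku_*$, independent of $i$ and $j$, such that for all $i,j\ge1$: 1. On $E^{\mu_1}$, whose source part is generated over $ku_*$ by the classes $[i,j]$, $$d_{\mu_1}[i,j]=u_1\,p\,v^{g_1}[i,j-g_1],$$ and this is nonzero if $j>g_1$. 2. On $E^{\mu_2}$, whose source part is generated over $ku_*$ by the classes $p[i,j]$ together with the classes $[i,j]$ with $j\le g_1$, $$d_{\mu_2}\bigl(p[i,j]\bigr)=u_2\,v^{g_1+g_2}[i-g_1,j-g_2],$$ and this is nonzero if $i>g_1$ and $j>g_2$; moreover $d_{\mu_2}[i,j]=0$ if $j\le g_1$. Here the class in $E^r$ "of $x$" in the source part, for $x=[i,j]$ or $x=p[i,j]$, is the class of any $r$-cycle of the form $x+(\text{terms of filtration}<|[i,j]|)$;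 such $r$-cycles exist in all the cases above. -/

import Mathlib

open scoped TensorProduct Polynomial

noncomputable section

namespace KuSS

/-- The ideal `(p)` of `ℤ` is prime. -/
instance isPrime_span (p : ℕ) [hp : Fact p.Prime] : (Ideal.span {(p : ℤ)}).IsPrime :=
  (Ideal.span_singleton_prime (by exact_mod_cast hp.out.ne_zero)).mpr
    (Nat.prime_iff_prime_int.mp hp.out)

/-- `ℤ` localized at the prime `p`. -/
def ZLoc (p : ℕ) [Fact p.Prime] : Type := Localization.AtPrime (Ideal.span {(p : ℤ)})

instance (p : ℕ) [Fact p.Prime] : CommRing (ZLoc p) :=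
  inferInstanceAs (CommRing (Localization.AtPrime (Ideal.span {(p : ℤ)})))

/-- The coefficient ring `ku_* = ℤ_(p)[v]` of `p`-local connective complex `K`-theory. -/
def Ku (p : ℕ) [Fact p.Prime] : Type := (ZLoc p)[X]

instance (p : ℕ) [Fact p.Prime] : CommRing (Ku p) := inferInstanceAs (CommRing (ZLoc p)[X])

/-- The Bott generator `v`. -/
def v (p : ℕ) [Fact p.Prime] : Ku p := (Polynomial.X : (ZLoc p)[X])

/-- `g_k = p ^ k - 1`. -/
def g (p k : ℕ) : ℕ := p ^ k - 1

/-- The coefficient `a_k = binom (p ^ n) (k + 1) * v ^ k` of the `[p ^ n]`-series. -/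
def a (p : ℕ) [Fact p.Prime] (n k : ℕ) : Ku p := ((p ^ n).choose (k + 1) : Ku p) * v p ^ k

/-- The free `ku_*`-module on generators `α_1, α_2, …`. -/
abbrev F (p : ℕ) [Fact p.Prime] : Type := ℕ+ →₀ Ku p

/-- The generator `α_i` for `i ≥ 1`, and `0` for `i ≤ 0`. -/
def α (p : ℕ) [Fact p.Prime] (i : ℤ) : F p :=
  if h : 0 < i then Finsupp.single ⟨i.toNat, by omega⟩ 1 else 0

/-- `∑_{k < p ^ n} a_k α_{i - k}`, with `a_k` the coefficients of the `[p ^ n]`-series. -/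
def seriesAt (p : ℕ) [Fact p.Prime] (n : ℕ) (i : ℤ) : F p :=
  ∑ k ∈ Finset.range (p ^ n), a p n k • α p (i - k)

/-- The submodule of relations imposed by the `[p ^ n]`-series. -/
def relations (p : ℕ) [Fact p.Prime] (n : ℕ) : Submodule (Ku p) (F p) :=
  Submodule.span (Ku p) (Set.range fun i : ℕ+ => seriesAt p n i)

/-- The reduced homology `ku_*(ℤ/p^n)`: generators `e_1, e_2, …` subject to the relations of the
`[p ^ n]`-series. -/
abbrev KuCyclic (p : ℕ) [Fact p.Prime] (n : ℕ) : Type := F p ⧸ relations p n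

/-- The class `e_j`, which is `0` for `j ≤ 0`. -/
def e (p : ℕ) [Fact p.Prime] (n : ℕ) (j : ℤ) : KuCyclic p n := (relations p n).mkQ (α p j)

/-- `F ⊗ ku_*(ℤ/p^n)`, the module in both degrees of the two-term complex. -/
def M (p : ℕ) [Fact p.Prime] (n : ℕ) : Type := F p ⊗[Ku p] KuCyclic p n

instance (p : ℕ) [Fact p.Prime] (n : ℕ) : AddCommGroup (M p n) :=
  inferInstanceAs (AddCommGroup (F p ⊗[Ku p] KuCyclic p n))

instance (p : ℕ) [Fact p.Prime] (n : ℕ) : Module (Ku p) (M p n) :=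
  inferInstanceAs (Module (Ku p) (F p ⊗[Ku p] KuCyclic p n))

/-- `[i, j] = α_i ⊗ e_j`. -/
def br (p : ℕ) [Fact p.Prime] (n : ℕ) (i j : ℤ) : M p n := α p i ⊗ₜ[Ku p] e p n j

/-- The differential `∂_t`, with `∂_t (α_i ⊗ e_j) = ∑_{k < p ^ t} a_k α_{i - k} ⊗ e_j`. -/
def bd (p : ℕ) [Fact p.Prime] (t n : ℕ) : M p n →ₗ[Ku p] M p n :=
  (LinearMap.rTensor (KuCyclic p n)
    (Finsupp.linearCombination (Ku p) fun i : ℕ+ => seriesAt p t i) :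
      F p ⊗[Ku p] KuCyclic p n →ₗ[Ku p] F p ⊗[Ku p] KuCyclic p n)

/-- The filtration degree `i (p ^ t + 1) + j (p ^ (t - 1) + 1)` of `[i, j]`. -/
def wt (p t : ℕ) (i j : ℤ) : ℤ := i * (p ^ t + 1) + j * (p ^ (t - 1) + 1)

/-- The elements of filtration at most `s`: the `ku_*`-combinations of the `[i, j]` of filtration
degree at most `s`. -/
def filt (p : ℕ) [Fact p.Prime] (t n : ℕ) (s : ℤ) : Submodule (Ku p) (M p n) :=
  Submodule.span (Ku p) {x | ∃ i j : ℕ+, wt p t i j ≤ s ∧ x = br p n i j}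

end KuSS

/-! The spectral sequence of a filtered complex `⋯ → 0 → C₁ → C₀ → 0 → ⋯` concentrated in two
degrees, with increasing filtrations `F₁`, `F₀`. For a general filtered complex
`E^r_s = Z^r_s / (Z^{r-1}_{s-1} + ∂ Z^{r-1}_{s+r-1})` with `Z^r_s = F_s ∩ ∂⁻¹ F_{s-r}`; in degree
`1` no boundaries come in, and in degree `0` every element is a cycle. -/
namespace TwoTermSS

variable {R C₁ C₀ : Type*} [CommRing R] [AddCommGroup C₁] [AddCommGroup C₀] [Module R C₁]
  [Module R C₀] (d : C₁ →ₗ[R] C₀) (F₁ : ℤ → Submodule R C₁) (F₀ : ℤ → Submodule R C₀)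

/-- `Z^r_s` in degree `1`: the elements of filtration `s` with boundary in filtration `s - r`. -/
def Z (r s : ℤ) : Submodule R C₁ := F₁ s ⊓ (F₀ (s - r)).comap d

/-- `E^r_s` in degree `1`, that is `Z^r_s / Z^{r-1}_{s-1}`. -/
abbrev E₁ (r s : ℤ) : Type _ :=
  Z d F₁ F₀ r s ⧸ (Z d F₁ F₀ (r - 1) (s - 1)).comap (Z d F₁ F₀ r s).subtype

/-- `E^r_s` in degree `0`, that is `F_s / (F_{s-1} + ∂ Z^{r-1}_{s+r-1})`. -/
abbrev E₀ (r s : ℤ) : Type _ :=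
  F₀ s ⧸ (F₀ (s - 1) ⊔ (Z d F₁ F₀ (r - 1) (s + r - 1)).map d).comap (F₀ s).subtype

/-- The differential `d_r : E^r_s → E^r_{s-r}` from degree `1` to degree `0`, induced by `∂`. -/
def dr (r s : ℤ) : E₁ d F₁ F₀ r s →ₗ[R] E₀ d F₁ F₀ r (s - r) :=
  Submodule.mapQ _ _
    ((d.comp (Z d F₁ F₀ r s).subtype).codRestrict (F₀ (s - r)) fun z => z.2.2) (by
      intro z hz
      refine Submodule.mem_sup_right ⟨z, ?_, rfl⟩
      have h : s - r + r - 1 = s - 1 := by ring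
      rw [h]
      exact hz)

/-- `ξ ∈ E^r_s` (degree `1`) is the class with leading term `x`: it is represented by some
`z ∈ Z^r_s` with `z = x + ` terms of lower filtration. -/
def IsClass₁ (r s : ℤ) (ξ : E₁ d F₁ F₀ r s) (x : C₁) : Prop :=
  ∃ z : Z d F₁ F₀ r s, (z : C₁) - x ∈ F₁ (s - 1) ∧ Submodule.Quotient.mk z = ξ

/-- `η ∈ E^r_s` (degree `0`) is the class of `y`. -/
def IsClass₀ (r s : ℤ) (η : E₀ d F₁ F₀ r s) (y : C₀) : Prop :=
  ∃ hy : y ∈ F₀ s, Submodule.Quotient.mk ⟨y, hy⟩ = η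

end TwoTermSS

namespace KuSS

/-- `E^r_s` in degree `1` for the filtered complex `∂_t : F ⊗ ku_*(ℤ/p^n) → F ⊗ ku_*(ℤ/p^n)`. -/
abbrev E₁ (p : ℕ) [Fact p.Prime] (t n : ℕ) (r s : ℤ) : Type :=
  TwoTermSS.E₁ (bd p t n) (filt p t n) (filt p t n) r s

/-- The differential `d_r` on `E^r_s` for this filtered complex. -/
abbrev dr (p : ℕ) [Fact p.Prime] (t n : ℕ) (r s : ℤ) :
    E₁ p t n r s →ₗ[Ku p]
      TwoTermSS.E₀ (bd p t n) (filt p t n) (filt p t n) r (s - r) :=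
  TwoTermSS.dr (bd p t n) (filt p t n) (filt p t n) r s

/-- `ξ ∈ E^r_s` is the class in degree `1` with leading term `x`. -/
abbrev IsClass₁ (p : ℕ) [Fact p.Prime] (t n : ℕ) (r s : ℤ) (ξ : E₁ p t n r s) (x : M p n) :
    Prop :=
  TwoTermSS.IsClass₁ (bd p t n) (filt p t n) (filt p t n) r s ξ x

/-- `η ∈ E^r_s` is the class in degree `0` of `y`. -/
abbrev IsClass₀ (p : ℕ) [Fact p.Prime] (t n : ℕ) (r s : ℤ)
    (η : TwoTermSS.E₀ (bd p t n) (filt p t n) (filt p t n) r s) (y : M p n) : Prop :=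
  TwoTermSS.IsClass₀ (bd p t n) (filt p t n) (filt p t n) r s η y

/-- The length `μ_1 = g_2`. -/
def μ₁ (p : ℕ) : ℕ := g p 2

/-- The length `μ_2 = g_1 (p ^ 2 + 1) + g_2 (p + 1)`. -/
def μ₂ (p : ℕ) : ℕ := g p 1 * (p ^ 2 + 1) + g p 2 * (p + 1)

end KuSS

end

/-!
The ring is `R = ℤ_(p)[v]`, and `c = binom (p ^ 2 - 1) (p - 1)`, a unit of `R` congruent to `1`
modulo `p`. Subtracting the relation of `ku_*(ℤ/p^2)` in the second index, the differential becomes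
`∂ [i, j] = ∑ a_k ([i - k, j] - [i, j - k])`, and the same relations express `p ^ 2 [i, j]` through
lower terms.

*First family.* The coefficients `a_k` with `0 < k < g_1` are divisible by `p ^ 2`, so the term of
highest filtration that survives is `- a_{g_1} [i, j - g_1] = - c p v ^ g_1 [i, j - g_1]`
(`bd_br_add_mem_filt`). All other error terms are of lower filtration, and are multiples either of
`p v ^ g_1` or of `v ^ g_2` (`bd_br_add_mem_Err'`). It follows by induction on the filtration that
multiples of `p v ^ g_1` are boundaries up to multiples of `v ^ g_2` of much lower filtration
(`V_le_map_bd_sup`).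

*Second family.* Put `b_k = a_k / p` for `k < g_2`. Since `a_{g_2} = v ^ g_2`, the relation says
`p ∑ b_k [i, j - k] = - v ^ g_2 [i, j - g_2]`, and hence `∂ (∑ b_k [i, j - k])` equals
`v ^ g_2 ∑ b_k [i - g_2, j - k] - v ^ g_2 ∑ b_k [i - k, j - g_2]` (`bd_sum_b_smul_br`). The
chain has leading term `p [i, j]`. The terms of the second sum with `k < g_1` are divisible by
`p v ^ g_1` and can be removed, the term with `k = g_1` is `- c v ^ (g_1 + g_2) [i - g_1, j - g_2]`,
and everything else is lower (`exists_lift_p_smul_br`). For `j ≤ g_1` the leading term of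
`∂ [i, j]` is zero, and the homogeneity of `∂` in total degree shows that a corrected chain
has a boundary below the range of `d_{μ_2}` (`exists_lift_br`).

*Nothing else.* Leading coefficients in `F ⊗ ku_*(ℤ/p^2)` are well defined modulo `p ^ 2`
(`smul_coord_br_eq_zero_iff`), which makes the differentials of the two families nonzero and, by
`mem_U_sup_filt`, determines all cycles up to the page `E^{μ_2}`. That no differential is longer
than `μ_2` means that leading coefficients of boundaries lie in the ideal
`(p ^ 2, p v ^ g_1, v ^ (g_1 + g_2))`: such leading terms are already hit by the two families
(`exists_bd_sub_bd_mem_filt`). The ideal is the intersection of `(p ^ 2, v ^ g_1)`, for which the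
claim is clear because it contains all the `a_k`, and `(p, v ^ (g_1 + g_2))`. For the latter, a
functional on the cokernel of `∂` with values in `R / (p ^ 3, v ^ (g_1 + g_2))`, taking the value
`p ^ 2` on `[i, j]` and vanishing on the other generators of filtration at most that of `[i, j]`,
is read off from the coefficients of a polynomial `Ψ` in two variables with constant term `p ^ 2`
that is annihilated by the series in either variable. Such a `Ψ` is
written down explicitly as `psi`, with the equation proved in `series_mul_psi`.
-/

namespace KuSS

/-! ### The coefficient ring and the binomial coefficients -/

section Ring

variable (p : ℕ) [hp : Fact p.Prime]

instance : IsDomain (ZLoc p) :=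
  inferInstanceAs (IsDomain (Localization.AtPrime (Ideal.span {(p : ℤ)})))

instance : IsDomain (Ku p) := inferInstanceAs (IsDomain (ZLoc p)[X])

instance : Algebra ℤ (ZLoc p) :=
  inferInstanceAs (Algebra ℤ (Localization.AtPrime (Ideal.span {(p : ℤ)})))

instance : IsLocalization.AtPrime (ZLoc p) (Ideal.span {(p : ℤ)}) :=
  inferInstanceAs (IsLocalization.AtPrime (Localization.AtPrime (Ideal.span {(p : ℤ)})) _)

theorem isUnit_intCast_zLoc_iff (m : ℤ) : IsUnit (m : ZLoc p) ↔ ¬ (p : ℤ) ∣ m := by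
  have h := IsLocalization.AtPrime.isUnit_to_map_iff (ZLoc p) (Ideal.span {(p : ℤ)}) m
  have e : algebraMap ℤ (ZLoc p) m = (m : ZLoc p) := eq_intCast _ m
  rw [e] at h
  rw [h, Ideal.mem_primeCompl_iff, Ideal.mem_span_singleton]

theorem isUnit_natCast {m : ℕ} (h : ¬ p ∣ m) : IsUnit (m : Ku p) := by
  have h1 : IsUnit ((m : ℤ) : ZLoc p) :=
    (isUnit_intCast_zLoc_iff p m).2 (by exact_mod_cast h)
  have h2 := h1.map (Polynomial.C : ZLoc p →+* (ZLoc p)[X])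
  rw [Int.cast_natCast, map_natCast] at h2
  exact h2

theorem natCast_prime_ne_zero : (p : Ku p) ≠ 0 := by
  have h : Function.Injective (algebraMap ℤ (ZLoc p)) :=
    IsLocalization.injective (ZLoc p)
      (Ideal.primeCompl_le_nonZeroDivisors (Ideal.span {(p : ℤ)}))
  have h1 : (p : ZLoc p) ≠ 0 := by
    intro h0
    have : algebraMap ℤ (ZLoc p) (p : ℤ) = algebraMap ℤ (ZLoc p) 0 := by
      rw [map_natCast, map_zero, h0]
    exact hp.out.ne_zero (by exact_mod_cast h this)
  intro h0
  have h2 : Polynomial.C (p : ZLoc p) = (0 : (ZLoc p)[X]) := by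
    rw [map_natCast]; exact h0
  exact h1 (Polynomial.C_eq_zero.1 h2)

theorem prime_dvd_iff (x : Ku p) :
    (p : Ku p) ∣ x ↔ ∀ n, (p : ZLoc p) ∣ Polynomial.coeff (R := ZLoc p) x n := by
  have : (p : Ku p) = (Polynomial.C (p : ZLoc p) : (ZLoc p)[X]) := (map_natCast _ p).symm
  rw [this]
  exact Polynomial.C_dvd_iff_dvd_coeff _ _

theorem prime_dvd_of_dvd_v_pow_mul {n : ℕ} {c : Ku p} (h : (p : Ku p) ∣ v p ^ n * c) :
    (p : Ku p) ∣ c := by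
  rw [prime_dvd_iff] at h ⊢
  intro k
  have := h (k + n)
  have e : Polynomial.coeff (R := ZLoc p) (v p ^ n * c) (k + n) =
      Polynomial.coeff (R := ZLoc p) c k := Polynomial.coeff_X_pow_mul (R := ZLoc p) c n k
  rwa [e] at this

theorem prime_not_dvd_v_pow (n : ℕ) : ¬ (p : Ku p) ∣ v p ^ n := by
  intro h
  rw [← mul_one (v p ^ n)] at h
  have h1 := prime_dvd_of_dvd_v_pow_mul p h
  rw [prime_dvd_iff] at h1
  have h2 := h1 0
  have h3 : IsUnit ((p : ℤ) : ZLoc p) := by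
    rw [Int.cast_natCast]
    refine isUnit_of_dvd_one (h2.trans ?_)
    change (1 : (ZLoc p)[X]).coeff 0 ∣ 1
    rw [Polynomial.coeff_one_zero]
  exact (isUnit_intCast_zLoc_iff p p).1 h3 dvd_rfl

end Ring

/-- The binomial coefficient `c = binom (p ^ 2 - 1) (p - 1)`, so that
`binom (p ^ 2) p = p * c`; both differentials carry the unit `-c`. -/
def cc (p : ℕ) : ℕ := (p ^ 2 - 1).choose (p - 1)

section Binomial

variable {p : ℕ}

theorem choose_sq_prime (hp : p.Prime) : (p ^ 2).choose p = p * cc p := by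
  obtain ⟨m, rfl⟩ : ∃ m, p = m + 1 := ⟨p - 1, by have := hp.pos; omega⟩
  have h := Nat.add_one_mul_choose_eq ((m + 1) ^ 2 - 1) m
  have h1 : (m + 1) ^ 2 - 1 + 1 = (m + 1) ^ 2 := Nat.sub_add_cancel (Nat.one_le_pow _ _ (by omega))
  rw [h1] at h
  have h2 : (m + 1) * ((m + 1) * cc (m + 1)) = (m + 1) * ((m + 1) ^ 2).choose (m + 1) := by
    rw [Nat.mul_comm (m + 1) (Nat.choose _ _), ← h]
    simp only [cc, Nat.add_sub_cancel]; ring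
  exact (Nat.eq_of_mul_eq_mul_left (by omega) h2).symm

theorem cc_modEq (hp : p.Prime) : cc p ≡ 1 [MOD p] := by
  have := Fact.mk hp
  have h := @Choose.choose_modEq_choose_mod_mul_choose_div_nat (p ^ 2 - 1) (p - 1) p _
  have h2 := hp.two_le
  have e1 : p ^ 2 - 1 = (p - 1) + p * (p - 1) := by
    obtain ⟨m, rfl⟩ : ∃ m, p = m + 1 := ⟨p - 1, by omega⟩
    simp only [Nat.add_sub_cancel]
    have : (m + 1) ^ 2 = m + (m + 1) * m + 1 := by ring
    omega
  have e2 : (p ^ 2 - 1) % p = p - 1 := by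
    rw [e1, Nat.add_mul_mod_self_left, Nat.mod_eq_of_lt (by omega)]
  have e3 : (p - 1) % p = p - 1 := Nat.mod_eq_of_lt (by omega)
  have e4 : (p - 1) / p = 0 := Nat.div_eq_of_lt (by omega)
  rw [e2, e3, e4] at h
  simpa [cc] using h

theorem prime_dvd_choose (hp : p.Prime) {k : ℕ} (h : k < p ^ 2 - 1) : p ∣ (p ^ 2).choose (k + 1) :=
  hp.dvd_choose_pow (by omega) (by omega)

theorem prime_sq_dvd_choose (hp : p.Prime) {k : ℕ} (h : ¬ p ∣ k + 1) :
    p ^ 2 ∣ (p ^ 2).choose (k + 1) := by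
  have h1 := Nat.add_one_mul_choose_eq (p ^ 2 - 1) k
  rw [Nat.sub_add_cancel (Nat.one_le_pow _ _ hp.pos)] at h1
  refine Nat.Coprime.dvd_of_dvd_mul_right (k := (p ^ 2)) (n := k + 1) ?_ ⟨_, h1.symm⟩
  exact Nat.Coprime.pow_left 2 ((Nat.Prime.coprime_iff_not_dvd hp).2 h)

theorem sub_one_mul_add_one (hp : p.Prime) : (p - 1) * (p + 1) = p ^ 2 - 1 := by
  obtain ⟨m, rfl⟩ : ∃ m, p = m + 1 := ⟨p - 1, by have := hp.pos; omega⟩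
  simp only [Nat.add_sub_cancel]
  have : (m + 1) ^ 2 = m * (m + 1 + 1) + 1 := by ring
  omega

end Binomial

end KuSS

namespace KuSS

/-! ### A truncated solution of the two series equations -/

section Psi

variable {A : Type*} [CommRing A] (p : ℕ)

/-- The polynomial `∑_{k < p - 1} (binom (p ^ 2) (k + 1) / p ^ 2) S ^ k`, which is the part of
`[p ^ 2](S) / (p ^ 2 S)` of degree less than `p - 1`. -/
def unitPart (S : A) : A :=
  ∑ k ∈ Finset.range (p - 1), (((p ^ 2).choose (k + 1) / p ^ 2 : ℕ) : A) * S ^ k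

/-- The `(p - 1)`-st power of the modified coordinate `S * unitPart p S`. -/
def sig (S : A) : A := (S * unitPart p S) ^ (p - 1)

/-- A solution `Ψ` of `([p ^ 2](S) / S) Ψ = ([p ^ 2](T) / T) Ψ = 0` modulo `p ^ 3` and modulo terms
of total degree at least `p ^ 2 + p - 2`, with constant term `p ^ 2`. -/
def psi (S T : A) : A :=
  (p : A) ^ 2 - p * ∑ i ∈ Finset.range (p + 1), sig p S ^ i * sig p T ^ (p - i) +
    ∑ i ∈ Finset.range p, sig p S ^ (i + 1) * sig p T ^ (p - i)

theorem psi_comm (S T : A) : psi p S T = psi p T S := by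
  unfold psi
  congr 1
  · congr 2
    rw [← Finset.sum_range_reflect]
    refine Finset.sum_congr rfl fun i hi => ?_
    have := Finset.mem_range.1 hi
    rw [mul_comm, show p - (p + 1 - 1 - i) = i by omega, show p + 1 - 1 - i = p - i by omega]
  · rw [← Finset.sum_range_reflect]
    refine Finset.sum_congr rfl fun i hi => ?_
    have := Finset.mem_range.1 hi
    rw [mul_comm, show p - (p - 1 - i) = i + 1 by omega, show p - 1 - i + 1 = p - i by omega]

theorem map_psi {B : Type*} [CommRing B] (φ : A →+* B) (S T : A) :
    φ (psi p S T) = psi p (φ S) (φ T) := by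
  simp [psi, sig, unitPart]

theorem psi_zero (hp : p.Prime) : psi p (0 : A) 0 = (p : A) ^ 2 := by
  have h0 : sig p (0 : A) = 0 := by
    rw [sig, zero_mul, zero_pow (by have := hp.two_le; omega)]
  unfold psi
  rw [h0, Finset.sum_eq_zero, Finset.sum_eq_zero]
  · simp
  · intro i _
    rw [zero_pow (by omega), zero_mul]
  · intro i hi
    rcases Nat.eq_zero_or_pos i with h | h
    · rw [h, zero_pow (n := p - 0) (by have := hp.pos; omega), mul_zero]
    · rw [zero_pow (by omega), zero_mul]

theorem exists_unitPart_eq (hp : p.Prime) (S : A) : ∃ y, unitPart p S = 1 + S * y := by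
  obtain ⟨m, hm⟩ : ∃ m, p - 1 = m + 1 := ⟨p - 2, by have := hp.two_le; omega⟩
  unfold unitPart
  rw [hm, Finset.sum_range_succ']
  refine ⟨∑ k ∈ Finset.range m, (((p ^ 2).choose (k + 1 + 1) / p ^ 2 : ℕ) : A) * S ^ k, ?_⟩
  rw [Finset.mul_sum, add_comm]
  congr 1
  · rw [zero_add, Nat.choose_one_right, Nat.div_self (pow_pos hp.pos 2)]; simp
  · exact Finset.sum_congr rfl fun k _ => by ring

/-- The series equation for `psi`. Modulo `p ^ 3` and in low degrees,
`([p ^ 2](S) / S) * psi` is `p ^ 2 (S ^ (p ^ 2 - 1) - S ^ (p - 1) X + w Y)` with `w` the unit part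
and `X`, `Y` the two sums in `psi`. In the same range `w σ = S ^ (p - 1)` and
`w σ ^ (p + 1) = S ^ (p ^ 2 - 1)`, because `w ^ p` is `1` modulo `p` and `S ^ p`; so the bracket is
`w (σ ^ (p + 1) - σ X + Y) = 0`. -/
theorem series_mul_psi (hp : p.Prime) (S T : A) (hp3 : (p : A) ^ 3 = 0)
    (hN : ∀ a b : ℕ, (p - 1) + (p ^ 2 - 1) ≤ a + b → S ^ a * T ^ b = 0) :
    (∑ k ∈ Finset.range (p ^ 2), ((p ^ 2).choose (k + 1) : A) * S ^ k) * psi p S T = 0 := by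
  have h2 := hp.two_le
  have hg := sub_one_mul_add_one hp
  have hpp : p * (p - 1) + (p - 1) = p ^ 2 - 1 := by rw [← hg]; ring
  have hq : p ^ 2 - 1 < p ^ 2 := by have := pow_pos hp.pos 2; omega
  set w := unitPart p S with hw
  set σ := sig p S with hσ
  set τ := sig p T with hτ
  set X := ∑ i ∈ Finset.range (p + 1), σ ^ i * τ ^ (p - i) with hX
  set Y := ∑ i ∈ Finset.range p, σ ^ (i + 1) * τ ^ (p - i) with hY
  have hz : ∀ k i j : ℕ, (p - 1) + (p ^ 2 - 1) ≤ k + (p - 1) * (i + j) →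
      S ^ k * (σ ^ i * τ ^ j) = 0 := by
    intro k i j h
    have : S ^ k * (σ ^ i * τ ^ j) = (S ^ (k + (p - 1) * i) * T ^ ((p - 1) * j)) *
        (w ^ ((p - 1) * i) * unitPart p T ^ ((p - 1) * j)) := by
      rw [hσ, hτ, sig, sig, ← pow_mul, ← pow_mul, mul_pow, mul_pow, pow_add]; ring
    rw [this, hN _ _ (by rw [add_assoc, ← mul_add]; exact h), zero_mul]
  have hSX : ∀ k, 2 * (p - 1) ≤ k → S ^ k * X = 0 := by
    intro k hk
    rw [hX, Finset.mul_sum]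
    refine Finset.sum_eq_zero fun i hi => hz _ _ _ ?_
    have := Finset.mem_range.1 hi
    rw [show i + (p - i) = p by omega, mul_comm _ p]; omega
  have hSY : ∀ k, p - 1 ≤ k → S ^ k * Y = 0 := by
    intro k hk
    rw [hY, Finset.mul_sum]
    refine Finset.sum_eq_zero fun i hi => hz _ _ _ ?_
    have := Finset.mem_range.1 hi
    rw [show i + 1 + (p - i) = p + 1 by omega, hg]; omega
  have hS : ∀ k, (p - 1) + (p ^ 2 - 1) ≤ k → S ^ k = 0 := fun k hk => by
    simpa using hN k 0 (by simpa using hk)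
  -- the three pieces of the product
  have e1 : (∑ k ∈ Finset.range (p ^ 2), ((p ^ 2).choose (k + 1) : A) * S ^ k) * (p : A) ^ 2 =
      (p : A) ^ 2 * S ^ (p ^ 2 - 1) := by
    rw [Finset.sum_mul, Finset.sum_eq_single (p ^ 2 - 1)]
    · rw [show p ^ 2 - 1 + 1 = p ^ 2 by omega, Nat.choose_self]; push_cast; ring
    · intro k hk hk'
      have := Finset.mem_range.1 hk
      obtain ⟨d, hd⟩ := prime_dvd_choose hp (k := k) (by omega)
      rw [hd]; push_cast
      linear_combination d * S ^ k * hp3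
    · intro h; exact absurd (Finset.mem_range.2 hq) h
  have e2 : (∑ k ∈ Finset.range (p ^ 2), ((p ^ 2).choose (k + 1) : A) * S ^ k) * (p * X) =
      (p : A) ^ 2 * S ^ (p - 1) * X := by
    rw [Finset.sum_mul, Finset.sum_eq_single (p - 1)]
    · rw [show p - 1 + 1 = p by omega, choose_sq_prime hp]
      obtain ⟨d, hd⟩ := (Nat.modEq_iff_dvd.1 (cc_modEq hp).symm)
      have : (cc p : A) = 1 + p * d := by
        have : ((cc p : ℤ) : A) = ((1 + p * d : ℤ) : A) := by
          rw [← hd]; push_cast; ring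
        push_cast at this; exact this
      push_cast
      rw [this]
      linear_combination d * S ^ (p - 1) * X * hp3
    · intro k hk hk'
      have := Finset.mem_range.1 hk
      by_cases hk2 : 2 * (p - 1) ≤ k
      · linear_combination ((p ^ 2).choose (k + 1) : A) * p * hSX k hk2
      · have : ¬ p ∣ k + 1 := by
          rintro ⟨m, hm⟩
          rcases m with _ | _ | m
          · omega
          · omega
          · have : p * (m + 1 + 1) = p * m + 2 * p := by ring
            omega
        obtain ⟨d, hd⟩ := prime_sq_dvd_choose hp this
        rw [hd]; push_cast
        linear_combination d * S ^ k * X * hp3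
    · intro h; exact absurd (Finset.mem_range.2 (by omega)) h
  have e3 : (∑ k ∈ Finset.range (p ^ 2), ((p ^ 2).choose (k + 1) : A) * S ^ k) * Y =
      (p : A) ^ 2 * w * Y := by
    clear_value X Y
    rw [hw, unitPart, Finset.sum_mul, Finset.mul_sum, Finset.sum_mul]
    symm
    have hsub : Finset.range (p - 1) ⊆ Finset.range (p ^ 2) := by
      intro k hk
      rw [Finset.mem_range] at *
      omega
    rw [← Finset.sum_subset hsub]
    · refine Finset.sum_congr rfl fun k hk => ?_
      have := Finset.mem_range.1 hk
      have hd := prime_sq_dvd_choose hp (k := k) (Nat.not_dvd_of_pos_of_lt (by omega) (by omega))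
      have h3 : ((p ^ 2).choose (k + 1) : A) =
          (p : A) ^ 2 * (((p ^ 2).choose (k + 1) / p ^ 2 : ℕ) : A) := by
        exact_mod_cast congrArg (Nat.cast : ℕ → A) (Nat.mul_div_cancel' hd).symm
      rw [h3]; ring
    · intro k _ hk
      rw [Finset.mem_range, not_lt] at hk
      linear_combination ((p ^ 2).choose (k + 1) : A) * hSY k hk
  -- the modified coordinate agrees with `S` up to the unit part
  obtain ⟨y, hy⟩ := exists_unitPart_eq p hp S
  obtain ⟨r, hr⟩ := exists_add_pow_prime_eq hp 1 (S * y)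
  rw [← hy, ← hw, one_pow, mul_pow] at hr
  have e4 : (p : A) ^ 2 * w * σ * X = (p : A) ^ 2 * S ^ (p - 1) * X := by
    have h1 : w * σ = S ^ (p - 1) * w ^ p := by
      rw [hσ, sig, mul_pow, ← hw]
      conv_rhs => rw [show p = p - 1 + 1 by omega, pow_succ, Nat.add_sub_cancel]
      ring
    have h3 := hSX (p - 1 + p) (by omega)
    rw [pow_add] at h3
    rw [mul_assoc ((p : A) ^ 2), h1, hr]
    linear_combination (S * y * S ^ (p - 1) * r * X) * hp3 + (p : A) ^ 2 * y ^ p * h3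
  have e5 : (p : A) ^ 2 * w * σ ^ (p + 1) = (p : A) ^ 2 * S ^ (p ^ 2 - 1) := by
    have h1 : w * σ ^ (p + 1) = S ^ (p ^ 2 - 1) * (w ^ p) ^ p := by
      rw [hσ, sig, ← pow_mul, hg, mul_pow, ← hw, ← pow_mul, ← sq]
      conv_rhs => rw [show p ^ 2 = p ^ 2 - 1 + 1 by omega, pow_succ w, Nat.add_sub_cancel]
      ring
    obtain ⟨z, hz'⟩ : ∃ z, (w ^ p) ^ p = 1 + (w ^ p - 1) * z := by
      obtain ⟨z, hz'⟩ := sub_dvd_pow_sub_pow (w ^ p) 1 p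
      exact ⟨z, by rw [← hz', one_pow]; ring⟩
    have h3 := hS (p ^ 2 - 1 + p) (by omega)
    rw [pow_add] at h3
    rw [mul_assoc, h1, hz', hr]
    linear_combination (S * y * S ^ (p ^ 2 - 1) * r * z) * hp3 + (p : A) ^ 2 * y ^ p * z * h3
  have e6 : σ * X = σ ^ (p + 1) + Y := by
    rw [hX, hY, Finset.sum_range_succ, Nat.sub_self, mul_add, Finset.mul_sum, add_comm]
    congr 1
    · ring
    · exact Finset.sum_congr rfl fun i _ => by ring
  have : psi p S T = (p : A) ^ 2 - p * X + Y := rfl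
  rw [this, mul_add, mul_sub, e1, e2, e3]
  linear_combination e4 - e5 - (p : A) ^ 2 * w * e6

end Psi

end KuSS

namespace KuSS

/-! ### The generators, the relations and the differential -/

section Weight

variable {p : ℕ}

theorem exists_pnat_eq {i : ℤ} (h : 0 < i) : ∃ n : ℕ+, (n : ℤ) = i :=
  ⟨⟨i.toNat, by omega⟩, Int.toNat_of_nonneg h.le⟩

theorem wt_pos {i j : ℤ} (hi : 0 < i) (hj : 0 < j) : 0 < wt p 2 i j := by
  unfold wt; positivity

theorem wt_sub_left (i j k : ℤ) : wt p 2 (i - k) j = wt p 2 i j - k * (p ^ 2 + 1) := by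
  unfold wt; ring

theorem wt_sub_right (i j k : ℤ) : wt p 2 i (j - k) = wt p 2 i j - k * (p + 1) := by
  unfold wt; norm_num; ring

theorem wt_add_right (i j k : ℤ) : wt p 2 i (j + k) = wt p 2 i j + k * (p + 1) := by
  unfold wt; norm_num; ring

end Weight

section Module

variable (p : ℕ) [hp : Fact p.Prime]

theorem α_of_nonpos {i : ℤ} (h : i ≤ 0) : α p i = 0 := by
  rw [α, dif_neg (by omega)]

theorem α_coe (i : ℕ+) : α p i = Finsupp.single i 1 := by
  have : (0 : ℤ) < i := by exact_mod_cast i.pos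
  rw [α, dif_pos this]
  congr 1

theorem seriesAt_of_nonpos (n : ℕ) {i : ℤ} (h : i ≤ 0) : seriesAt p n i = 0 :=
  Finset.sum_eq_zero fun k _ => by rw [α_of_nonpos p (by omega), smul_zero]

theorem br_of_nonpos_left (n : ℕ) {i : ℤ} (j : ℤ) (h : i ≤ 0) : br p n i j = 0 := by
  rw [br, α_of_nonpos p h]; exact TensorProduct.zero_tmul _ _

theorem br_of_nonpos_right (n : ℕ) (i : ℤ) {j : ℤ} (h : j ≤ 0) : br p n i j = 0 := by
  rw [br, e, α_of_nonpos p h, map_zero]; exact TensorProduct.tmul_zero _ _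

theorem sum_a_smul_e (n : ℕ) (j : ℤ) :
    ∑ k ∈ Finset.range (p ^ n), a p n k • e p n (j - k) = 0 := by
  have h : ∑ k ∈ Finset.range (p ^ n), a p n k • e p n (j - k) =
      (relations p n).mkQ (seriesAt p n j) := by
    simp only [seriesAt, map_sum, map_smul, e]
  rw [h]
  rcases le_or_gt j 0 with hj | hj
  · rw [seriesAt_of_nonpos p n hj, map_zero]
  · rw [Submodule.mkQ_apply, Submodule.Quotient.mk_eq_zero]
    obtain ⟨j, rfl⟩ := exists_pnat_eq hj
    exact Submodule.subset_span ⟨j, rfl⟩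

theorem sum_a_smul_br (n : ℕ) (i j : ℤ) :
    ∑ k ∈ Finset.range (p ^ n), a p n k • br p n i (j - k) = 0 := by
  have h := congrArg (fun y => (TensorProduct.mk (Ku p) (F p) (KuCyclic p n) (α p i)) y)
    (sum_a_smul_e p n j)
  simp only [map_sum, map_smul, map_zero] at h
  exact h

theorem bd_br (t n : ℕ) (i j : ℤ) :
    bd p t n (br p n i j) = ∑ k ∈ Finset.range (p ^ t), a p t k • br p n (i - k) j := by
  have h : bd p t n (br p n i j) = seriesAt p t i ⊗ₜ[Ku p] e p n j := by
    have h1 : bd p t n (br p n i j) = (Finsupp.linearCombination (Ku p)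
        fun i : ℕ+ => seriesAt p t i) (α p i) ⊗ₜ[Ku p] e p n j := rfl
    rw [h1]
    congr 1
    rcases le_or_gt i 0 with hi | hi
    · rw [seriesAt_of_nonpos p t hi, α_of_nonpos p hi, map_zero]
    · obtain ⟨i, rfl⟩ := exists_pnat_eq hi
      rw [α_coe, Finsupp.linearCombination_single, one_smul]
  rw [h, seriesAt, TensorProduct.sum_tmul]
  exact Finset.sum_congr rfl fun k _ => (TensorProduct.smul_tmul' _ _ _).symm

/-- The differential of `[i, j]`, rewritten with the relation of `ku_*(ℤ/p^2)` subtracted. -/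
theorem bd_br_eq_sub (i j : ℤ) :
    bd p 2 2 (br p 2 i j) =
      ∑ k ∈ Finset.range (p ^ 2), a p 2 k • (br p 2 (i - k) j - br p 2 i (j - k)) := by
  rw [bd_br, ← sub_zero (∑ k ∈ _, _), ← sum_a_smul_br p 2 i j, ← Finset.sum_sub_distrib]
  exact Finset.sum_congr rfl fun k _ => (smul_sub _ _ _).symm

/-! ### Submodules of bounded total degree and filtration -/

/-- The span of the multiples `r [i, j]` with `i + j ≤ n` and `[i, j]` of filtration at most `s`.
Bounding the total degree as well as the filtration records that all maps are homogeneous for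
`v` of degree `1` and `[i, j]` of degree `i + j`. -/
noncomputable def V (r : Ku p) (n s : ℤ) : Submodule (Ku p) (M p 2) :=
  Submodule.span (Ku p) {x | ∃ i j : ℕ+, (i : ℤ) + j ≤ n ∧ wt p 2 i j ≤ s ∧ x = r • br p 2 i j}

variable {p}

theorem V_mono {r r' : Ku p} {n n' s s' : ℤ} (hr : r' ∣ r) (hn : n ≤ n') (hs : s ≤ s') :
    V p r n s ≤ V p r' n' s' := by
  refine Submodule.span_le.2 ?_
  rintro _ ⟨i, j, h1, h2, rfl⟩
  obtain ⟨d, rfl⟩ := hr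
  rw [mul_comm, mul_smul]
  exact Submodule.smul_mem _ _ (Submodule.subset_span ⟨i, j, h1.trans hn, h2.trans hs, rfl⟩)

theorem smul_br_mem_V {c r : Ku p} {n s i j : ℤ} (hr : r ∣ c) (hn : i + j ≤ n)
    (hs : wt p 2 i j ≤ s) : c • br p 2 i j ∈ V p r n s := by
  rcases le_or_gt i 0 with hi | hi
  · rw [br_of_nonpos_left p 2 j hi, smul_zero]; exact zero_mem _
  rcases le_or_gt j 0 with hj | hj
  · rw [br_of_nonpos_right p 2 i hj, smul_zero]; exact zero_mem _
  obtain ⟨i, rfl⟩ := exists_pnat_eq hi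
  obtain ⟨j, rfl⟩ := exists_pnat_eq hj
  exact V_mono hr le_rfl le_rfl (Submodule.subset_span ⟨i, j, hn, hs, rfl⟩)

theorem V_le_filt (r : Ku p) (n s : ℤ) : V p r n s ≤ filt p 2 2 s := by
  refine Submodule.span_le.2 ?_
  rintro _ ⟨i, j, -, h2, rfl⟩
  exact Submodule.smul_mem _ _ (Submodule.subset_span ⟨i, j, h2, rfl⟩)

theorem filt_mono {s s' : ℤ} (h : s ≤ s') : filt p 2 2 s ≤ filt p 2 2 s' := by
  refine Submodule.span_mono ?_
  rintro _ ⟨i, j, h1, rfl⟩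
  exact ⟨i, j, h1.trans h, rfl⟩

theorem smul_br_mem_filt (c : Ku p) {s i j : ℤ} (hs : wt p 2 i j ≤ s) :
    c • br p 2 i j ∈ filt p 2 2 s :=
  V_le_filt 1 (i + j) s (smul_br_mem_V (one_dvd c) le_rfl hs)

theorem br_mem_filt {s i j : ℤ} (hs : wt p 2 i j ≤ s) : br p 2 i j ∈ filt p 2 2 s := by
  simpa using smul_br_mem_filt 1 hs

theorem coe_g_one : ((g p 1 : ℕ) : ℤ) = p - 1 := by
  have := hp.out.pos
  simp only [g, pow_one]; omega

theorem coe_g_two : ((g p 2 : ℕ) : ℤ) = p ^ 2 - 1 := by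
  have := pow_pos hp.out.pos 2
  rw [g, Nat.cast_sub (by omega)]; push_cast; ring

theorem coe_μ₁ : ((μ₁ p : ℕ) : ℤ) = p ^ 2 - 1 := coe_g_two

theorem coe_μ₂ : ((μ₂ p : ℕ) : ℤ) = (p - 1) * (p ^ 2 + 1) + (p ^ 2 - 1) * (p + 1) := by
  rw [μ₂]; push_cast; rw [coe_g_one, coe_g_two]

theorem two_le_coe : (2 : ℤ) ≤ p := by exact_mod_cast hp.out.two_le

theorem g_one_lt_g_two : g p 1 < g p 2 := by
  have hp2 := two_le_coe (p := p)
  have : (g p 1 : ℤ) < g p 2 := by rw [coe_g_one, coe_g_two]; nlinarith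
  exact_mod_cast this

/-! ### The approximate form of the differential -/

theorem a_top : a p 2 (g p 2) = v p ^ g p 2 := by
  have : g p 2 + 1 = p ^ 2 := Nat.sub_add_cancel (Nat.one_le_pow _ _ hp.out.pos)
  rw [a, this, Nat.choose_self, Nat.cast_one, one_mul]

theorem a_g_one : a p 2 (g p 1) = (cc p : Ku p) * (p * v p ^ g p 1) := by
  have : g p 1 + 1 = p := by
    have := hp.out.pos
    simp only [g, pow_one]; omega
  rw [a, this, choose_sq_prime hp.out]; push_cast; ring

theorem dvd_a {k : ℕ} (h1 : g p 1 ≤ k) (h2 : k < g p 2) : (p : Ku p) * v p ^ g p 1 ∣ a p 2 k := by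
  refine mul_dvd_mul ?_ (pow_dvd_pow _ h1)
  exact_mod_cast Nat.cast_dvd_cast (prime_dvd_choose hp.out h2)

theorem sq_dvd_a {k : ℕ} (h1 : k < g p 1) : (p : Ku p) ^ 2 ∣ a p 2 k := by
  refine Dvd.dvd.mul_right ?_ _
  have := prime_sq_dvd_choose hp.out (k := k)
    (Nat.not_dvd_of_pos_of_lt (by omega) (by simp only [g, pow_one] at h1; omega))
  exact_mod_cast Nat.cast_dvd_cast (α := Ku p) this

theorem isUnit_cc : IsUnit (cc p : Ku p) := by
  refine isUnit_natCast p fun h => ?_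
  have h1 := (Nat.modEq_zero_iff_dvd.2 h).symm.trans (cc_modEq hp.out)
  have := (Nat.modEq_iff_dvd' (Nat.zero_le 1)).1 h1
  exact hp.out.one_lt.ne' (Nat.dvd_one.1 this)

variable (p) in
/-- The submodule in which `p ^ 2 [i, j]` lies when `i + j = n` and `[i, j]` has filtration `s`. -/
noncomputable def Err (n s : ℤ) : Submodule (Ku p) (M p 2) :=
  V p (p * v p ^ g p 1) (n - g p 1) (s - μ₁ p) ⊔
    V p (v p ^ g p 2) (n - g p 2) (s - g p 2 * (p + 1))

variable (p) in
/-- The submodule in which `[i, j]` has its differential, up to the leading term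
`- c p v ^ g_1 [i, j - g_1]`, when `i + j = n` and `[i, j]` has filtration `s`. -/
noncomputable def Err' (n s : ℤ) : Submodule (Ku p) (M p 2) :=
  V p (p * v p ^ g p 1) (n - g p 1) (s - μ₁ p - 1) ⊔
    V p (v p ^ g p 2) (n - g p 2) (s - g p 2 * (p + 1))

theorem Err_mono {n n' s s' : ℤ} (hn : n ≤ n') (hs : s ≤ s') : Err p n s ≤ Err p n' s' :=
  sup_le_sup (V_mono dvd_rfl (by omega) (by omega)) (V_mono dvd_rfl (by omega) (by omega))

theorem Err_le_Err' {n n' s s' : ℤ} (hn : n ≤ n') (hs : s + 1 ≤ s') : Err p n s ≤ Err' p n' s' :=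
  sup_le_sup (V_mono dvd_rfl (by omega) (by omega)) (V_mono dvd_rfl (by omega) (by omega))

theorem sq_smul_br_mem_Err (i j : ℤ) :
    (p : Ku p) ^ 2 • br p 2 i j ∈ Err p (i + j) (wt p 2 i j) := by
  obtain ⟨N, hN⟩ : ∃ N : ℕ, j ≤ N := ⟨j.toNat, by omega⟩
  induction N using Nat.strong_induction_on generalizing j with
  | _ N ih =>
  rcases le_or_gt j 0 with hj | hj
  · rw [br_of_nonpos_right p 2 i hj, smul_zero]; exact zero_mem _
  have hp2 := two_le_coe (p := p)
  have h := sum_a_smul_br p 2 i j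
  have hsucc : p ^ 2 = g p 2 + 1 :=
    (Nat.sub_add_cancel (Nat.one_le_pow _ _ hp.out.pos)).symm
  rw [hsucc, Finset.sum_range_succ'] at h
  have h0 : a p 2 0 • br p 2 i (j - (0 : ℕ)) = (p : Ku p) ^ 2 • br p 2 i j := by
    simp [a]
  rw [h0] at h
  rw [eq_neg_of_add_eq_zero_right h]
  refine neg_mem (Submodule.sum_mem _ fun k hk => ?_)
  have hk := Finset.mem_range.1 hk
  have hkp : (0 : ℤ) ≤ ((k + 1 : ℕ) : ℤ) * (p + 1) := by positivity
  rcases lt_or_ge (k + 1) (g p 1) with h1 | h1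
  · obtain ⟨d, hd⟩ := sq_dvd_a h1
    rw [hd, mul_comm, mul_smul]
    refine Submodule.smul_mem _ _ (Err_mono ?_ ?_ (ih (N - 1) (by omega) _ ?_))
    · omega
    · rw [wt_sub_right]; omega
    · push_cast; omega
  rcases lt_or_ge (k + 1) (g p 2) with h2 | h2
  · refine Submodule.mem_sup_left (smul_br_mem_V (dvd_a h1 h2) (by omega) ?_)
    rw [wt_sub_right, coe_μ₁]
    have : (g p 1 : ℤ) ≤ ((k + 1 : ℕ) : ℤ) := by exact_mod_cast h1
    rw [coe_g_one] at this
    nlinarith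
  · have h3 : k + 1 = g p 2 := by omega
    rw [h3]
    refine Submodule.mem_sup_right (smul_br_mem_V (dvd_of_eq ?_) (by omega) ?_)
    · rw [a_top]
    · rw [wt_sub_right]

/-- The leading term of the differential of `[i, j]` is `- c p v ^ g_1 [i, j - g_1]`. -/
theorem bd_br_add_mem_Err' (i j : ℤ) :
    bd p 2 2 (br p 2 i j) + ((cc p : Ku p) * (p * v p ^ g p 1)) • br p 2 i (j - g p 1) ∈
      Err' p (i + j) (wt p 2 i j) := by
  have hp2 := two_le_coe (p := p)
  have hg1 := coe_g_one (p := p)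
  have hg2 := coe_g_two (p := p)
  have hlt := g_one_lt_g_two (p := p)
  have hsucc : p ^ 2 = g p 2 + 1 :=
    (Nat.sub_add_cancel (Nat.one_le_pow _ _ hp.out.pos)).symm
  have hmem : g p 1 ∈ Finset.range (p ^ 2) := Finset.mem_range.2 (by omega)
  rw [bd_br_eq_sub, ← Finset.add_sum_erase _ _ hmem, ← a_g_one, add_right_comm, smul_sub,
    sub_add_cancel]
  have hsplit : ∀ k : ℕ, (1 : ℤ) ≤ k → (k : ℤ) * (p + 1) + 1 ≤ k * (p ^ 2 + 1) := by
    intro k hk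
    nlinarith
  refine add_mem ?_ (Submodule.sum_mem _ fun k hk => ?_)
  · refine Submodule.mem_sup_left (smul_br_mem_V (dvd_a le_rfl hlt) (by omega) ?_)
    rw [wt_sub_left, coe_μ₁]
    have := hsplit (g p 1) (by omega)
    rw [hg1] at this ⊢
    nlinarith
  rw [Finset.mem_erase, Finset.mem_range] at hk
  rcases Nat.eq_zero_or_pos k with h0 | h0
  · subst h0; simp
  have h0' : (1 : ℤ) ≤ k := by exact_mod_cast h0
  have hs := hsplit k h0'
  have hkp : (1 : ℤ) ≤ (k : ℤ) * (p + 1) := by nlinarith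
  rw [smul_sub]
  rcases lt_or_ge k (g p 1) with h1 | h1
  · obtain ⟨d, hd⟩ := sq_dvd_a h1
    rw [hd, mul_comm, mul_smul, mul_smul, ← smul_sub]
    refine Submodule.smul_mem _ _ (sub_mem ?_ ?_)
    · refine Err_le_Err' ?_ ?_ (sq_smul_br_mem_Err _ _)
      · omega
      · rw [wt_sub_left]; omega
    · refine Err_le_Err' ?_ ?_ (sq_smul_br_mem_Err _ _)
      · omega
      · rw [wt_sub_right]; omega
  rcases lt_or_ge k (g p 2) with h2 | h2
  · have h3 : (g p 1 : ℤ) + 1 ≤ k := by exact_mod_cast lt_of_le_of_ne h1 (Ne.symm hk.1)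
    rw [hg1] at h3
    have h4 : ((p : ℤ) - 1) * (p + 1) + 1 ≤ k * (p + 1) := by nlinarith
    refine Submodule.mem_sup_left (sub_mem (smul_br_mem_V (dvd_a h1 h2) (by omega) ?_)
      (smul_br_mem_V (dvd_a h1 h2) (by omega) ?_))
    · rw [wt_sub_left, coe_μ₁]; nlinarith
    · rw [wt_sub_right, coe_μ₁]; nlinarith
  · have h3 : k = g p 2 := by omega
    rw [h3]
    rw [h3] at hs
    refine Submodule.mem_sup_right (sub_mem (smul_br_mem_V (dvd_of_eq a_top.symm) (by omega) ?_)
      (smul_br_mem_V (dvd_of_eq a_top.symm) (by omega) ?_))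
    · rw [wt_sub_left]; omega
    · rw [wt_sub_right]

theorem bd_br_add_mem_filt (i j : ℤ) :
    bd p 2 2 (br p 2 i j) + ((cc p : Ku p) * (p * v p ^ g p 1)) • br p 2 i (j - g p 1) ∈
      filt p 2 2 (wt p 2 i j - μ₁ p - 1) := by
  refine (sup_le ?_ ?_ : Err' p (i + j) (wt p 2 i j) ≤ _) (bd_br_add_mem_Err' i j)
  · exact V_le_filt _ _ _
  · refine (V_le_filt _ _ _).trans (filt_mono ?_)
    have hp2 := two_le_coe (p := p)
    rw [coe_g_two, coe_μ₁]
    nlinarith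

theorem bd_mem_filt {s : ℤ} {z : M p 2} (hz : z ∈ filt p 2 2 s) :
    bd p 2 2 z ∈ filt p 2 2 (s - μ₁ p) := by
  refine (Submodule.span_le (p := (filt p 2 2 (s - μ₁ p)).comap (bd p 2 2))).2 ?_ hz
  rintro _ ⟨i, j, h, rfl⟩
  have h1 := filt_mono (by omega : wt p 2 i j - μ₁ p - 1 ≤ s - μ₁ p)
    (bd_br_add_mem_filt (p := p) i j)
  refine (add_mem_cancel_right (smul_br_mem_filt _ ?_)).1 h1
  rw [wt_sub_right, coe_g_one, coe_μ₁]
  nlinarith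

end Module

end KuSS

namespace KuSS

/-! ### Lifting leading terms through the differential -/

section Lift

variable {p : ℕ} [hp : Fact p.Prime]

theorem V_eq_bot {r : Ku p} {n s : ℤ} (hs : s ≤ 0) : V p r n s = ⊥ := by
  refine Submodule.span_eq_bot.2 ?_
  rintro _ ⟨i, j, -, h, -⟩
  have := wt_pos (p := p) (i := i) (j := j) (by exact_mod_cast i.pos) (by exact_mod_cast j.pos)
  omega

/-- Multiples of `p v ^ g_1` are boundaries, up to multiples of `v ^ g_2` of lower filtration:
the leading term of `∂ [i, j + g_1]` is `p v ^ g_1 [i, j]` up to a unit, and the error terms that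
are not multiples of `v ^ g_2` are again multiples of `p v ^ g_1`. -/
theorem V_le_map_bd_sup (m t : ℤ) :
    V p (p * v p ^ g p 1) m t ≤ (V p 1 (m + g p 1) (t + μ₁ p)).map (bd p 2 2) ⊔
      V p (v p ^ g p 2) (m + g p 1 - g p 2) (t + μ₁ p - g p 2 * (p + 1)) := by
  obtain ⟨N, hN⟩ : ∃ N : ℕ, t ≤ N := ⟨t.toNat, by omega⟩
  induction N generalizing t with
  | zero => rw [V_eq_bot (by simpa using hN)]; exact bot_le
  | succ N ih =>
  set W := (V p 1 (m + g p 1) (t + μ₁ p)).map (bd p 2 2) ⊔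
      V p (v p ^ g p 2) (m + g p 1 - g p 2) (t + μ₁ p - g p 2 * (p + 1)) with hW
  have ih' : V p (p * v p ^ g p 1) m (t - 1) ≤ W := by
    refine (ih (t - 1) (by push_cast at hN; omega)).trans ?_
    exact sup_le_sup (Submodule.map_mono (V_mono dvd_rfl le_rfl (by omega)))
      (V_mono dvd_rfl le_rfl (by omega))
  refine Submodule.span_le.2 ?_
  rintro _ ⟨i, j, h1, h2, rfl⟩
  have hwt : wt p 2 i (j + g p 1) = wt p 2 i j + μ₁ p := by
    rw [wt_add_right, coe_g_one, coe_μ₁]; ring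
  have h := bd_br_add_mem_Err' (p := p) i (j + g p 1)
  rw [add_sub_cancel_right] at h
  have hErr : Err' p (i + (j + g p 1)) (wt p 2 i (j + g p 1)) ≤ W := by
    refine sup_le (le_trans (V_mono dvd_rfl (by omega) (by omega)) ih')
      (le_trans (V_mono dvd_rfl (by omega) (by omega)) le_sup_right)
  have hbd : bd p 2 2 (br p 2 i (j + g p 1)) ∈ W := by
    refine Submodule.mem_sup_left (Submodule.mem_map_of_mem ?_)
    rw [← one_smul (Ku p) (br p 2 i (j + g p 1))]
    exact smul_br_mem_V dvd_rfl (by omega) (by omega)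
  have h3 := (add_mem_cancel_left hbd).1 (hErr h)
  rw [mul_smul] at h3
  exact (Submodule.smul_mem_iff_of_isUnit W isUnit_cc).1 h3

/-- For `j ≤ g_1` the class of `[i, j]` survives past the second family of differentials. The
total degree bound forces the error terms, multiples of `v ^ g_2`, into low filtration. -/
theorem exists_lift_br (i j : ℤ) (hj : j ≤ g p 1) :
    ∃ B : M p 2, B - br p 2 i j ∈ filt p 2 2 (wt p 2 i j - 1) ∧
      bd p 2 2 B ∈ filt p 2 2 (wt p 2 i j - μ₂ p - 1) := by
  have h := bd_br_add_mem_Err' (p := p) i j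
  rw [br_of_nonpos_right p 2 i (by omega : j - (g p 1 : ℤ) ≤ 0), smul_zero, add_zero] at h
  obtain ⟨x₁, hx₁, x₂, hx₂, h⟩ := Submodule.mem_sup.1 h
  obtain ⟨_, ⟨y, hy, rfl⟩, x₃, hx₃, h'⟩ := Submodule.mem_sup.1 (V_le_map_bd_sup _ _ hx₁)
  refine ⟨br p 2 i j - y, ?_, ?_⟩
  · rw [sub_sub_cancel_left]
    exact neg_mem (filt_mono (by omega) (V_le_filt _ _ _ hy))
  · have e : bd p 2 2 (br p 2 i j - y) = x₃ + x₂ := by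
      rw [map_sub, ← h, ← h']; abel
    have hV : ∀ s, V p (v p ^ g p 2) (i + j - g p 2) s ≤ filt p 2 2 (wt p 2 i j - μ₂ p - 1) := by
      refine fun s => Submodule.span_le.2 ?_
      rintro _ ⟨i', j', h1, -, rfl⟩
      refine smul_br_mem_filt _ ?_
      have hj' : (1 : ℤ) ≤ j' := by exact_mod_cast j'.pos
      have hp2 := two_le_coe (p := p)
      rw [coe_g_two] at h1
      rw [coe_g_one] at hj
      rw [coe_μ₂]
      simp only [wt, Nat.add_one_sub_one, pow_one]
      -- at worst `j' = 1`, `j = g_1` and `i' = i + j - g_2 - 1`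
      have hi' : (i' : ℤ) ≤ i + j - (p ^ 2 - 1) - j' := by omega
      have e1 := mul_le_mul_of_nonneg_right hi' (by positivity : (0 : ℤ) ≤ p ^ 2 + 1)
      have e2 : (0 : ℤ) ≤ (j' - 1) * (p ^ 2 - p) := mul_nonneg (by omega) (by nlinarith)
      have e3 : (0 : ℤ) ≤ (p - 1 - j) * (p ^ 2 - p) := mul_nonneg (by omega) (by nlinarith)
      have e4 : (0 : ℤ) ≤ (p - 2) * (p * (p * (p - 1))) :=
        mul_nonneg (by omega) (mul_nonneg (by omega) (mul_nonneg (by omega) (by omega)))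
      nlinarith
    rw [e]
    refine add_mem (hV _ (V_mono dvd_rfl (by omega) le_rfl hx₃)) (hV _ hx₂)

variable (p) in
/-- The coefficients `a_k / p` for `k < g_2`. -/
noncomputable def b (k : ℕ) : Ku p := ((p ^ 2).choose (k + 1) / p : ℕ) * v p ^ k

theorem p_mul_b {k : ℕ} (hk : k < g p 2) : (p : Ku p) * b p k = a p 2 k := by
  rw [b, a, ← mul_assoc]
  congr 1
  exact_mod_cast congrArg (Nat.cast : ℕ → Ku p) (Nat.mul_div_cancel' (prime_dvd_choose hp.out hk))

/-- The differential of `∑ (a_k / p) [i, j - k]`: as `a_k = p b_k` for `k < g_2` and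
`a_{g_2} = v ^ g_2`, the relation turns `p ∑ b_k [i, j - k]` into `- v ^ g_2 [i, j - g_2]`. -/
theorem bd_sum_b_smul_br (i j : ℤ) :
    bd p 2 2 (∑ k ∈ Finset.range (g p 2), b p k • br p 2 i (j - k)) =
      v p ^ g p 2 • ∑ k ∈ Finset.range (g p 2), b p k • br p 2 (i - g p 2) (j - k) -
      v p ^ g p 2 • ∑ k ∈ Finset.range (g p 2), b p k • br p 2 (i - k) (j - g p 2) := by
  have hsucc : p ^ 2 = g p 2 + 1 :=
    (Nat.sub_add_cancel (Nat.one_le_pow _ _ hp.out.pos)).symm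
  have hrel : ∀ i j : ℤ, (p : Ku p) • ∑ k ∈ Finset.range (g p 2), b p k • br p 2 i (j - k) =
      - (v p ^ g p 2 • br p 2 i (j - g p 2)) := by
    intro i j
    have h := sum_a_smul_br p 2 i j
    rw [hsucc, Finset.sum_range_succ, a_top] at h
    rw [← eq_neg_of_add_eq_zero_left h, Finset.smul_sum]
    refine Finset.sum_congr rfl fun k hk => ?_
    rw [smul_smul, p_mul_b (Finset.mem_range.1 hk)]
  have h1 : bd p 2 2 (∑ k ∈ Finset.range (g p 2), b p k • br p 2 i (j - k)) =
      ∑ l ∈ Finset.range (p ^ 2), a p 2 l •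
        ∑ k ∈ Finset.range (g p 2), b p k • br p 2 (i - l) (j - k) := by
    simp only [map_sum, map_smul, bd_br, Finset.smul_sum]
    rw [Finset.sum_comm]
    exact Finset.sum_congr rfl fun l _ => Finset.sum_congr rfl fun k _ => smul_comm _ _ _
  have h2 : ∑ l ∈ Finset.range (g p 2), a p 2 l •
        ∑ k ∈ Finset.range (g p 2), b p k • br p 2 (i - l) (j - k) =
      -(v p ^ g p 2 • ∑ k ∈ Finset.range (g p 2), b p k • br p 2 (i - k) (j - g p 2)) := by
    rw [Finset.smul_sum, ← Finset.sum_neg_distrib]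
    refine Finset.sum_congr rfl fun l hl => ?_
    rw [smul_comm, ← smul_neg, ← hrel, ← p_mul_b (Finset.mem_range.1 hl), mul_comm, mul_smul]
  rw [h1, hsucc, Finset.sum_range_succ, a_top, h2, neg_add_eq_sub]

theorem b_zero : b p 0 = p := by
  have : p ^ 2 / p = p := by rw [sq, Nat.mul_div_cancel _ hp.out.pos]
  simp [b, this]

theorem b_g_one : b p (g p 1) = cc p * v p ^ g p 1 := by
  have : g p 1 + 1 = p := by
    have := hp.out.pos
    simp only [g, pow_one]; omega
  rw [b, this, choose_sq_prime hp.out, Nat.mul_div_cancel_left _ hp.out.pos]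

theorem dvd_b {k : ℕ} (h : k < g p 1) : (p : Ku p) ∣ b p k := by
  obtain ⟨d, hd⟩ := prime_sq_dvd_choose hp.out (k := k)
    (Nat.not_dvd_of_pos_of_lt (by omega) (by simp only [g, pow_one] at h; omega))
  rw [b, hd, sq, mul_assoc, Nat.mul_div_cancel_left _ hp.out.pos]
  rw [Nat.cast_mul, mul_assoc]
  exact dvd_mul_right _ _

/-- The class of `p [i, j]` survives to the second family of differentials, where its boundary has
leading term `- c v ^ (g_1 + g_2) [i - g_1, j - g_2]`. -/
theorem exists_lift_p_smul_br (i j : ℤ) :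
    ∃ A : M p 2, A - (p : Ku p) • br p 2 i j ∈ filt p 2 2 (wt p 2 i j - 1) ∧
      bd p 2 2 A + ((cc p : Ku p) * v p ^ (g p 1 + g p 2)) • br p 2 (i - g p 1) (j - g p 2) ∈
        filt p 2 2 (wt p 2 i j - μ₂ p - 1) := by
  have hp2 := two_le_coe (p := p)
  have hg1 := coe_g_one (p := p)
  have hg2 := coe_g_two (p := p)
  have hm1 := coe_μ₁ (p := p)
  have hm2 := coe_μ₂ (p := p)
  have hlt := g_one_lt_g_two (p := p)
  have hwt : wt p 2 i (j - g p 2) = wt p 2 i j - (p ^ 2 - 1) * (p + 1) := by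
    rw [wt_sub_right, hg2]
  set s := wt p 2 i j with hs
  set x := ∑ k ∈ Finset.range (g p 1), b p k • br p 2 (i - k) (j - g p 2) with hx
  have hxV : v p ^ g p 2 • x ∈
      V p (p * v p ^ g p 1) (i + j - g p 2) (s - (p ^ 2 - 1) * (p + 1)) := by
    rw [hx, Finset.smul_sum]
    refine Submodule.sum_mem _ fun k hk => ?_
    rw [smul_smul]
    refine smul_br_mem_V ?_ (by omega) ?_
    · rw [mul_comm (v p ^ g p 2)]
      exact mul_dvd_mul (dvd_b (Finset.mem_range.1 hk)) (pow_dvd_pow _ hlt.le)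
    · rw [wt_sub_left, hwt]
      have : (0 : ℤ) ≤ k * (p ^ 2 + 1) := by positivity
      omega
  obtain ⟨_, ⟨y, hy, rfl⟩, x₃, hx₃, h'⟩ := Submodule.mem_sup.1 (V_le_map_bd_sup _ _ hxV)
  refine ⟨∑ k ∈ Finset.range (g p 2), b p k • br p 2 i (j - k) + y, ?_, ?_⟩
  · obtain ⟨n, hn⟩ : ∃ n, g p 2 = n + 1 := ⟨g p 2 - 1, by omega⟩
    rw [hn, Finset.sum_range_succ', b_zero, Nat.cast_zero, sub_zero, add_right_comm,
      add_sub_cancel_right]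
    refine add_mem (Submodule.sum_mem _ fun k _ => smul_br_mem_filt _ ?_)
      (filt_mono ?_ (V_le_filt _ _ _ hy))
    · rw [wt_sub_right]; push_cast; nlinarith
    · rw [hm1]; nlinarith
  · have hmid : g p 1 ∈ Finset.range (g p 2) := Finset.mem_range.2 hlt
    have hsub : Finset.range (g p 1) ⊆ (Finset.range (g p 2)).erase (g p 1) := by
      intro k hk
      simp only [Finset.mem_erase, Finset.mem_range] at hk ⊢
      omega
    have hsum : ∑ k ∈ Finset.range (g p 2), b p k • br p 2 (i - k) (j - g p 2) =
        b p (g p 1) • br p 2 (i - g p 1) (j - g p 2) +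
        (∑ k ∈ (Finset.range (g p 2)).erase (g p 1) \ Finset.range (g p 1),
          b p k • br p 2 (i - k) (j - g p 2) + x) := by
      rw [hx, Finset.sum_sdiff hsub]
      exact (Finset.add_sum_erase _ (fun k : ℕ => b p k • br p 2 (i - k) (j - g p 2)) hmid).symm
    have key : bd p 2 2 (∑ k ∈ Finset.range (g p 2), b p k • br p 2 i (j - k) + y) +
        ((cc p : Ku p) * v p ^ (g p 1 + g p 2)) • br p 2 (i - g p 1) (j - g p 2) =
        v p ^ g p 2 • ∑ k ∈ Finset.range (g p 2), b p k • br p 2 (i - g p 2) (j - k) -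
        v p ^ g p 2 • (∑ k ∈ (Finset.range (g p 2)).erase (g p 1) \ Finset.range (g p 1),
          b p k • br p 2 (i - k) (j - g p 2)) - x₃ := by
      rw [map_add, bd_sum_b_smul_br, hsum, eq_sub_of_add_eq h', b_g_one, smul_add, smul_add,
        smul_smul, show v p ^ g p 2 * (cc p * v p ^ g p 1) = cc p * v p ^ (g p 1 + g p 2) by ring]
      abel
    rw [key]
    refine sub_mem (sub_mem ?_ ?_) ?_
    · rw [Finset.smul_sum]
      refine Submodule.sum_mem _ fun k _ => ?_
      rw [smul_smul]
      refine smul_br_mem_filt _ ?_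
      rw [wt_sub_left, wt_sub_right, hg2, hm2]
      have : (0 : ℤ) ≤ k * (p + 1) := by positivity
      nlinarith [mul_nonneg (by omega : (0 : ℤ) ≤ p - 2) (by positivity : (0 : ℤ) ≤ p ^ 3),
        mul_nonneg (by omega : (0 : ℤ) ≤ p - 2) (by positivity : (0 : ℤ) ≤ p ^ 2)]
    · rw [Finset.smul_sum]
      refine Submodule.sum_mem _ fun k hk => ?_
      rw [smul_smul]
      refine smul_br_mem_filt _ ?_
      rw [Finset.mem_sdiff, Finset.mem_erase, Finset.mem_range, Finset.mem_range] at hk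
      have hk1 : (g p 1 : ℤ) + 1 ≤ k := by
        have : g p 1 + 1 ≤ k := by omega
        exact_mod_cast this
      rw [wt_sub_left, hwt, hm2]
      rw [hg1] at hk1
      nlinarith
    · refine filt_mono ?_ (V_le_filt _ _ _ hx₃)
      rw [hm1, hm2, hg2]
      nlinarith

end Lift

end KuSS

namespace KuSS

/-! ### Functionals detecting leading terms -/

section Functional

variable {p : ℕ} [hp : Fact p.Prime]

/-- The relations are triangular with diagonal entries `p ^ 2`. -/
theorem sq_dvd_of_mem_relations {x : F p} (hx : x ∈ relations p 2) {j : ℕ+}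
    (h : ∀ l, j < l → x l = 0) : (p : Ku p) ^ 2 ∣ x j := by
  have hdiag : ∀ l : ℕ+, seriesAt p 2 l l = (p : Ku p) ^ 2 := by
    intro l
    rw [seriesAt, Finsupp.finsetSum_apply, Finset.sum_eq_single 0]
    · rw [Nat.cast_zero, sub_zero, α_coe]; simp [a]
    · intro k _ hk
      rcases le_or_gt ((l : ℤ) - k) 0 with h0 | h0
      · rw [α_of_nonpos p h0]; simp
      · obtain ⟨m, hm⟩ := exists_pnat_eq h0
        rw [← hm, α_coe, Finsupp.smul_apply, Finsupp.single_eq_of_ne, smul_zero]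
        rintro rfl
        omega
    · intro h0
      exact absurd (Finset.mem_range.2 (pow_pos hp.out.pos 2)) h0
  have hupper : ∀ l m : ℕ+, l < m → seriesAt p 2 l m = 0 := by
    intro l m hlm
    rw [seriesAt, Finsupp.finsetSum_apply]
    refine Finset.sum_eq_zero fun k _ => ?_
    rcases le_or_gt ((l : ℤ) - k) 0 with h0 | h0
    · rw [α_of_nonpos p h0]; simp
    · obtain ⟨n, hn⟩ := exists_pnat_eq h0
      rw [← hn, α_coe, Finsupp.smul_apply, Finsupp.single_eq_of_ne, smul_zero]
      rintro rfl
      have : (l : ℤ) < m := by exact_mod_cast hlm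
      omega
  obtain ⟨c, rfl⟩ := Finsupp.mem_span_range_iff_exists_finsupp.1 hx
  have hval : ∀ m, (∀ l, m < l → c l = 0) →
      (c.sum fun i d => d • seriesAt p 2 i) m = c m * (p : Ku p) ^ 2 := by
    intro m hm
    rw [Finsupp.sum, Finsupp.finsetSum_apply, Finset.sum_eq_single m]
    · rw [Finsupp.smul_apply, hdiag, smul_eq_mul]
    · intro l _ hl
      rcases lt_or_gt_of_ne hl with h1 | h1
      · rw [Finsupp.smul_apply, hupper l m h1, smul_zero]
      · rw [hm l h1, zero_smul, Finsupp.zero_apply]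
    · intro hm'
      rw [Finsupp.notMem_support_iff.1 hm', zero_smul, Finsupp.zero_apply]
  have hc : ∀ l, j < l → c l = 0 := by
    by_contra! hcon
    obtain ⟨l, hl, hcl⟩ := hcon
    have hne : c.support.Nonempty := ⟨l, Finsupp.mem_support_iff.2 hcl⟩
    set m := c.support.max' hne with hm
    have hlm : l ≤ m := Finset.le_max' _ _ (Finsupp.mem_support_iff.2 hcl)
    have h1 := hval m fun l hl => by
      by_contra h0
      exact absurd (Finset.le_max' _ _ (Finsupp.mem_support_iff.2 h0)) (not_le.2 hl)
    rw [h m (hl.trans_le hlm)] at h1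
    rcases mul_eq_zero.1 h1.symm with h2 | h2
    · exact Finsupp.mem_support_iff.1 (Finset.max'_mem _ hne) h2
    · exact natCast_prime_ne_zero p (pow_eq_zero_iff (two_ne_zero) |>.1 h2)
  rw [hval j hc]
  exact dvd_mul_left _ _

variable (p) in
/-- The submodule of `ku_*(ℤ/p^2)` spanned by the `e_l` with `l < j`. -/
noncomputable def lowE (j : ℕ+) : Submodule (Ku p) (KuCyclic p 2) :=
  Submodule.span (Ku p) {x | ∃ l : ℕ+, l < j ∧ x = e p 2 l}

theorem smul_e_mem_lowE_iff {c : Ku p} {j : ℕ+} :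
    c • e p 2 j ∈ lowE p j ↔ (p : Ku p) ^ 2 ∣ c := by
  constructor
  · intro h
    have hmap : lowE p j =
        (Submodule.span (Ku p) {x | ∃ l : ℕ+, l < j ∧ x = α p l}).map (relations p 2).mkQ := by
      have hset : {x | ∃ l : ℕ+, l < j ∧ x = e p 2 l} =
          (relations p 2).mkQ '' {x | ∃ l : ℕ+, l < j ∧ x = α p l} := by
        ext x
        constructor
        · rintro ⟨l, hl, rfl⟩; exact ⟨_, ⟨l, hl, rfl⟩, rfl⟩
        · rintro ⟨_, ⟨l, hl, rfl⟩, rfl⟩; exact ⟨l, hl, rfl⟩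
      rw [Submodule.map_span, lowE, hset]
    rw [hmap] at h
    obtain ⟨y, hy, hyc⟩ := h
    have hy0 : ∀ l, j ≤ l → y l = 0 := by
      intro l hl
      refine (Submodule.span_le (p := LinearMap.ker (Finsupp.lapply (R := Ku p) l))).2 ?_ hy
      rintro _ ⟨m, hm, rfl⟩
      simp only [SetLike.mem_coe, LinearMap.mem_ker, Finsupp.lapply_apply]
      rw [α_coe, Finsupp.single_eq_of_ne (hm.trans_le hl).ne']
    have hmem : c • α p j - y ∈ relations p 2 := by
      rw [← Submodule.Quotient.mk_eq_zero, ← Submodule.mkQ_apply, map_sub, hyc, map_smul, e,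
        sub_self]
    have h2 := sq_dvd_of_mem_relations hmem (j := j) fun l hl => by
      rw [Finsupp.sub_apply, hy0 l hl.le, Finsupp.smul_apply, α_coe,
        Finsupp.single_eq_of_ne hl.ne', smul_zero, sub_zero]
    rw [Finsupp.sub_apply, hy0 j le_rfl, Finsupp.smul_apply, α_coe, Finsupp.single_eq_same,
      sub_zero, smul_eq_mul, mul_one] at h2
    exact h2
  · rintro ⟨d, rfl⟩
    rw [mul_comm, mul_smul]
    refine Submodule.smul_mem _ _ ?_
    have h := sum_a_smul_e p 2 (j : ℤ)
    have hsucc : p ^ 2 = g p 2 + 1 :=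
      (Nat.sub_add_cancel (Nat.one_le_pow _ _ hp.out.pos)).symm
    rw [hsucc, Finset.sum_range_succ'] at h
    have h0 : a p 2 0 • e p 2 ((j : ℤ) - (0 : ℕ)) = (p : Ku p) ^ 2 • e p 2 j := by simp [a]
    rw [h0] at h
    rw [eq_neg_of_add_eq_zero_right h]
    refine neg_mem (Submodule.sum_mem _ fun k _ => Submodule.smul_mem _ _ ?_)
    rcases le_or_gt ((j : ℤ) - (k + 1 : ℕ)) 0 with hj | hj
    · rw [e, α_of_nonpos p hj, map_zero]; exact zero_mem _
    · obtain ⟨l, hl⟩ := exists_pnat_eq hj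
      refine Submodule.subset_span ⟨l, ?_, by rw [hl]⟩
      have : (l : ℤ) < j := by rw [hl]; push_cast; omega
      exact_mod_cast this

/-- `φ` only sees the `[i, j]` with `i ≥ i₀` and `j ≥ j₀`. Among the `[i, j]` of filtration at most
that of `[i₀, j₀]` the only such one is `[i₀, j₀]`, so that `φ` reads off a leading coefficient. -/
def Detects {N : Type*} [AddCommGroup N] [Module (Ku p) N] (φ : M p 2 →ₗ[Ku p] N) (i₀ j₀ : ℤ) :
    Prop :=
  ∀ i j : ℤ, i < i₀ ∨ j < j₀ → φ (br p 2 i j) = 0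

theorem lt_or_lt_of_wt_le {i j i₀ j₀ : ℤ} (h : wt p 2 i j ≤ wt p 2 i₀ j₀)
    (hne : ¬ (i = i₀ ∧ j = j₀)) : i < i₀ ∨ j < j₀ := by
  by_contra! hcon
  obtain ⟨h1, h2⟩ := hcon
  refine hne ?_
  have hp2 := two_le_coe (p := p)
  simp only [wt, Nat.add_one_sub_one, pow_one] at h
  constructor
  · by_contra h3
    have : i₀ + 1 ≤ i := by omega
    nlinarith
  · by_contra h3
    have : j₀ + 1 ≤ j := by omega
    nlinarith

theorem Detects.eq_zero_of_mem_filt {N : Type*} [AddCommGroup N] [Module (Ku p) N]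
    {φ : M p 2 →ₗ[Ku p] N} {i₀ j₀ s : ℤ} (hφ : Detects φ i₀ j₀) (hs : s < wt p 2 i₀ j₀)
    {z : M p 2} (hz : z ∈ filt p 2 2 s) : φ z = 0 := by
  refine (Submodule.span_le (p := LinearMap.ker φ)).2 ?_ hz
  rintro _ ⟨i, j, h, rfl⟩
  refine hφ i j (lt_or_lt_of_wt_le (h.trans hs.le) ?_)
  rintro ⟨h1, h2⟩
  rw [h1, h2] at h
  omega

variable (p) in
/-- The functional on `F ⊗ ku_*(ℤ/p^2)` given by the `α_i`-coordinate, read modulo the `e_l` with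
`l < j`. -/
noncomputable def coord (i j : ℕ+) : M p 2 →ₗ[Ku p] KuCyclic p 2 ⧸ lowE p j :=
  (lowE p j).mkQ ∘ₗ (TensorProduct.lid (Ku p) (KuCyclic p 2)).toLinearMap ∘ₗ
    (LinearMap.rTensor (KuCyclic p 2) (Finsupp.lapply i) :
      F p ⊗[Ku p] KuCyclic p 2 →ₗ[Ku p] Ku p ⊗[Ku p] KuCyclic p 2)

theorem coord_br (i₀ j₀ : ℕ+) (i j : ℤ) :
    coord p i₀ j₀ (br p 2 i j) = (lowE p j₀).mkQ (α p i i₀ • e p 2 j) := rfl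

theorem coord_br_of_ne (i₀ j₀ : ℕ+) {i : ℤ} (j : ℤ) (h : i ≠ i₀) :
    coord p i₀ j₀ (br p 2 i j) = 0 := by
  rcases le_or_gt i 0 with h0 | h0
  · rw [br_of_nonpos_left p 2 j h0, map_zero]
  · obtain ⟨i, rfl⟩ := exists_pnat_eq h0
    rw [coord_br, α_coe, Finsupp.single_eq_of_ne, zero_smul, map_zero]
    rintro rfl
    exact h rfl

theorem detects_coord (i₀ j₀ : ℕ+) : Detects (coord p i₀ j₀) i₀ j₀ := by
  rintro i j (h | h)
  · exact coord_br_of_ne i₀ j₀ j h.ne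
  · rcases le_or_gt j 0 with h0 | h0
    · rw [br_of_nonpos_right p 2 i h0, map_zero]
    · obtain ⟨j, rfl⟩ := exists_pnat_eq h0
      rw [coord_br, map_smul, Submodule.mkQ_apply, (Submodule.Quotient.mk_eq_zero _).2, smul_zero]
      exact Submodule.subset_span ⟨j, by exact_mod_cast h, rfl⟩

theorem smul_coord_br_eq_zero_iff (i j : ℕ+) (c : Ku p) :
    c • coord p i j (br p 2 i j) = 0 ↔ (p : Ku p) ^ 2 ∣ c := by
  rw [coord_br, α_coe, Finsupp.single_eq_same, one_smul, ← map_smul, Submodule.mkQ_apply,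
    Submodule.Quotient.mk_eq_zero, smul_e_mem_lowE_iff]

/-- A doubly indexed family in a module, compatible with the relations of `ku_*(ℤ/p^2)` and
annihilated by the differential, defines a functional on the cokernel of the differential. -/
theorem exists_functional {N : Type*} [AddCommGroup N] [Module (Ku p) N] (c : ℤ → ℤ → N)
    (h0 : ∀ i j : ℤ, i ≤ 0 ∨ j ≤ 0 → c i j = 0)
    (hrel : ∀ i j : ℤ, ∑ k ∈ Finset.range (p ^ 2), a p 2 k • c i (j - k) = 0)
    (hbd : ∀ i j : ℤ, ∑ k ∈ Finset.range (p ^ 2), a p 2 k • c (i - k) j = 0) :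
    ∃ φ : M p 2 →ₗ[Ku p] N, (∀ i j : ℤ, φ (br p 2 i j) = c i j) ∧ ∀ z, φ (bd p 2 2 z) = 0 := by
  have hα : ∀ (i : ℕ+) (j : ℤ),
      Finsupp.linearCombination (Ku p) (fun j : ℕ+ => c i j) (α p j) = c i j := by
    intro i j
    rcases le_or_gt j 0 with hj | hj
    · rw [α_of_nonpos p hj, map_zero, h0 _ _ (Or.inr hj)]
    · obtain ⟨j, rfl⟩ := exists_pnat_eq hj
      rw [α_coe, Finsupp.linearCombination_single, one_smul]
  let row : ℕ+ → (KuCyclic p 2 →ₗ[Ku p] N) := fun i =>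
    (relations p 2).liftQ (Finsupp.linearCombination (Ku p) fun j : ℕ+ => c i j) (by
      refine Submodule.span_le.2 ?_
      rintro _ ⟨j, rfl⟩
      simp only [SetLike.mem_coe, LinearMap.mem_ker, seriesAt, map_sum, map_smul, hα]
      exact hrel i j)
  have hrow : ∀ (i : ℕ+) (j : ℤ), row i (e p 2 j) = c i j := fun i j => hα i j
  let φ : M p 2 →ₗ[Ku p] N :=
    (TensorProduct.lift (Finsupp.linearCombination (Ku p) row) :
      F p ⊗[Ku p] KuCyclic p 2 →ₗ[Ku p] N)
  have hφ : ∀ i j : ℤ, φ (br p 2 i j) = c i j := by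
    intro i j
    rcases le_or_gt i 0 with hi | hi
    · rw [br_of_nonpos_left p 2 j hi, map_zero, h0 _ _ (Or.inl hi)]
    · obtain ⟨i, rfl⟩ := exists_pnat_eq hi
      have : φ (br p 2 i j) = (Finsupp.linearCombination (Ku p) row (α p i)) (e p 2 j) := rfl
      rw [this, α_coe, Finsupp.linearCombination_single, one_smul, hrow]
  refine ⟨φ, hφ, fun z => ?_⟩
  have hz : φ ∘ₗ bd p 2 2 = 0 := by
    refine TensorProduct.ext (Finsupp.lhom_ext' fun i => LinearMap.ext_ring ?_)
    refine Submodule.linearMap_qext _ (Finsupp.lhom_ext' fun j => LinearMap.ext_ring ?_)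
    have : φ (bd p 2 2 (br p 2 i j)) = 0 := by
      rw [bd_br, map_sum]
      simp only [map_smul, hφ]
      exact hbd i j
    rw [br, e, α_coe, α_coe] at this
    exact this
  exact LinearMap.congr_fun hz z

end Functional

end KuSS

namespace KuSS

section Coker

variable {p : ℕ} [hp : Fact p.Prime]

variable (p) in
/-- The ideal `(p ^ 2, v ^ g_1)`. -/
noncomputable def I₁ : Ideal (Ku p) := Ideal.span {(p : Ku p) ^ 2, v p ^ g p 1}

variable (p) in
/-- The ideal `(p ^ 3, v ^ (g_1 + g_2))`. -/
noncomputable def I₂ : Ideal (Ku p) := Ideal.span {(p : Ku p) ^ 3, v p ^ (g p 1 + g p 2)}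

/-- All coefficients of the series lie in `(p ^ 2, v ^ g_1)`, so modulo this ideal the coefficient
of `[i₀, j₀]` vanishes on boundaries. -/
theorem exists_detects_I₁ (i₀ j₀ : ℕ+) :
    ∃ φ : M p 2 →ₗ[Ku p] Ku p ⧸ I₁ p, Detects φ i₀ j₀ ∧ (∀ z, φ (bd p 2 2 z) = 0) ∧
      φ (br p 2 i₀ j₀) = 1 := by
  have ha : ∀ (k : ℕ) (x : Ku p ⧸ I₁ p), a p 2 k • x = 0 := by
    intro k x
    have hk : a p 2 k ∈ I₁ p := by
      rcases lt_or_ge k (g p 1) with h | h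
      · exact Ideal.mem_of_dvd _ (sq_dvd_a h) (Ideal.subset_span (by simp))
      · exact Ideal.mem_of_dvd _ (Dvd.dvd.mul_left (pow_dvd_pow _ h) _)
          (Ideal.subset_span (by simp))
    rw [Algebra.smul_def, Ideal.Quotient.algebraMap_eq, Ideal.Quotient.eq_zero_iff_mem.2 hk,
      zero_mul]
  obtain ⟨φ, h1, h2⟩ := exists_functional (p := p)
    (fun i j : ℤ => if i = i₀ ∧ j = j₀ then (1 : Ku p ⧸ I₁ p) else 0)
    (by
      have := i₀.pos
      have := j₀.pos
      exact fun i j h => if_neg (by omega))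
    (fun i j => Finset.sum_eq_zero fun k _ => ha k _)
    (fun i j => Finset.sum_eq_zero fun k _ => ha k _)
  refine ⟨φ, fun i j h => ?_, h2, ?_⟩
  · rw [h1, if_neg (by omega)]
  · rw [h1, if_pos ⟨rfl, rfl⟩]

/-- The coefficient of `Y ^ i X ^ j` in a polynomial in `Y` over polynomials in `X`, with integer
indices. -/
noncomputable def coeff₂ {K : Type*} [CommRing K] (P : K[X][X]) (i j : ℤ) : K :=
  if 0 ≤ i ∧ 0 ≤ j then (P.coeff i.toNat).coeff j.toNat else 0

section Coeff

variable {K : Type*} [CommRing K]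

theorem coeff₂_sum {ι : Type*} (s : Finset ι) (P : ι → K[X][X]) (i j : ℤ) :
    coeff₂ (∑ k ∈ s, P k) i j = ∑ k ∈ s, coeff₂ (P k) i j := by
  unfold coeff₂
  split_ifs
  · rw [Polynomial.finsetSum_coeff, Polynomial.finsetSum_coeff]
  · rw [Finset.sum_const_zero]

theorem coeff₂_monomial_left (x : K) (k : ℕ) (P : K[X][X]) (i j : ℤ) :
    coeff₂ (Polynomial.C (Polynomial.C x) * Polynomial.X ^ k * P) i j =
      x * coeff₂ P (i - k) j := by
  unfold coeff₂
  by_cases hj : 0 ≤ j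
  · by_cases hi : 0 ≤ i
    · rw [if_pos ⟨hi, hj⟩, mul_assoc, Polynomial.coeff_C_mul, Polynomial.coeff_C_mul,
        Polynomial.coeff_X_pow_mul']
      by_cases hk : k ≤ i.toNat
      · rw [if_pos hk, if_pos ⟨by omega, hj⟩, show (i - k).toNat = i.toNat - k by omega]
      · rw [if_neg hk, if_neg (by omega), Polynomial.coeff_zero]
    · rw [if_neg (by tauto), if_neg (by omega), mul_zero]
  · rw [if_neg (by tauto), if_neg (by tauto), mul_zero]

theorem coeff₂_monomial_right (x : K) (k : ℕ) (P : K[X][X]) (i j : ℤ) :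
    coeff₂ (Polynomial.C (Polynomial.C x * Polynomial.X ^ k) * P) i j =
      x * coeff₂ P i (j - k) := by
  unfold coeff₂
  by_cases hi : 0 ≤ i
  · by_cases hj : 0 ≤ j
    · rw [if_pos ⟨hi, hj⟩, Polynomial.coeff_C_mul, mul_assoc, Polynomial.coeff_C_mul,
        Polynomial.coeff_X_pow_mul']
      by_cases hk : k ≤ j.toNat
      · rw [if_pos hk, if_pos ⟨hi, by omega⟩, show (j - k).toNat = j.toNat - k by omega]
      · rw [if_neg hk, if_neg (by omega)]
    · rw [if_neg (by tauto), if_neg (by omega), mul_zero]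
  · rw [if_neg (by tauto), if_neg (by tauto), mul_zero]

end Coeff

/-- The coefficients of `psi p (v Y) (v X)`, shifted to `(i₀, j₀)`, form a functional on the
cokernel of the differential. -/
theorem exists_detects_of_pow_eq_zero {K : Type*} [CommRing K] [Algebra (Ku p) K]
    (hK : (p : K) ^ 3 = 0) (hv : algebraMap (Ku p) K (v p) ^ (g p 1 + g p 2) = 0) (i₀ j₀ : ℕ+) :
    ∃ φ : M p 2 →ₗ[Ku p] K, Detects φ i₀ j₀ ∧ (∀ z, φ (bd p 2 2 z) = 0) ∧
      φ (br p 2 i₀ j₀) = (p : K) ^ 2 := by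
  let π : Ku p →+* K := algebraMap (Ku p) K
  let S : K[X][X] := Polynomial.C (Polynomial.C (π (v p))) * Polynomial.X
  let T : K[X][X] := Polynomial.C (Polynomial.C (π (v p)) * Polynomial.X)
  have hp3 : (p : K[X][X]) ^ 3 = 0 := by
    have h' := congrArg (fun x => Polynomial.C (Polynomial.C x)) hK
    simpa using h'
  have hST : ∀ a b : ℕ, (p - 1) + (p ^ 2 - 1) ≤ a + b → S ^ a * T ^ b = 0 := by
    intro a b hab
    have : S ^ a * T ^ b = Polynomial.C (Polynomial.C (π (v p) ^ (a + b))) *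
        (Polynomial.X ^ a * Polynomial.C Polynomial.X ^ b) := by
      simp only [S, T, mul_pow, pow_add, map_mul, map_pow]; ring
    rw [this, pow_eq_zero_of_le (by simpa [g] using hab) hv]; simp
  have hS := series_mul_psi p hp.out S T hp3 hST
  have hT := series_mul_psi p hp.out T S hp3 fun a b h => by
    rw [mul_comm]; exact hST b a (by omega)
  rw [psi_comm p T S] at hT
  rw [Finset.sum_mul] at hS hT
  have hsmul : ∀ (k : ℕ) (x : K), a p 2 k • x = π (a p 2 k) * x := fun k x =>
    Algebra.smul_def _ _
  have hSk : ∀ k, (((p ^ 2).choose (k + 1) : ℕ) : K[X][X]) * S ^ k =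
      Polynomial.C (Polynomial.C (π (a p 2 k))) * Polynomial.X ^ k := by
    intro k
    simp only [S, a, mul_pow, map_mul, map_pow, map_natCast]; ring
  have hTk : ∀ k, (((p ^ 2).choose (k + 1) : ℕ) : K[X][X]) * T ^ k =
      Polynomial.C (Polynomial.C (π (a p 2 k)) * Polynomial.X ^ k) := by
    intro k
    simp only [T, a, mul_pow, map_mul, map_pow, map_natCast]; ring
  have hsub : ∀ (i i₀ : ℤ) (k : ℕ), i - k - i₀ = i - i₀ - k := fun i i₀ k => by ring
  obtain ⟨φ, h1, h2⟩ := exists_functional (p := p)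
    (fun i j : ℤ => coeff₂ (psi p S T) (i - i₀) (j - j₀))
    (by
      have := i₀.pos
      have := j₀.pos
      exact fun i j h => if_neg (by omega))
    (fun i j => by
      have h := congrArg (fun P => coeff₂ P (i - i₀) (j - j₀)) hT
      simp only [coeff₂_sum, hTk, coeff₂_monomial_right] at h
      simp only [hsmul, hsub j j₀]
      rw [h]; simp [coeff₂])
    (fun i j => by
      have h := congrArg (fun P => coeff₂ P (i - i₀) (j - j₀)) hS
      simp only [coeff₂_sum, hSk, coeff₂_monomial_left] at h
      simp only [hsmul, hsub i i₀]
      rw [h]; simp [coeff₂])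
  refine ⟨φ, fun i j h => ?_, h2, ?_⟩
  · rw [h1]
    exact if_neg (by omega)
  · rw [h1, sub_self, sub_self]
    have h3 : coeff₂ (psi p S T) 0 0 =
        (Polynomial.constantCoeff.comp Polynomial.constantCoeff) (psi p S T) := by
      simp [coeff₂]
    rw [h3, map_psi]
    have hS0 : (Polynomial.constantCoeff.comp Polynomial.constantCoeff) S = 0 := by simp [S]
    have hT0 : (Polynomial.constantCoeff.comp Polynomial.constantCoeff) T = 0 := by simp [T]
    rw [hS0, hT0, psi_zero p hp.out]

/-- The annihilator of `p ^ 2` in `ku_* / I₂` is `(p, v ^ (g_1 + g_2))`, so this functional detects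
all multiples of `[i₀, j₀]` in the cokernel whose coefficient is not in that ideal. -/
theorem exists_detects_I₂ (i₀ j₀ : ℕ+) :
    ∃ φ : M p 2 →ₗ[Ku p] Ku p ⧸ I₂ p, Detects φ i₀ j₀ ∧ (∀ z, φ (bd p 2 2 z) = 0) ∧
      φ (br p 2 i₀ j₀) = (p : Ku p ⧸ I₂ p) ^ 2 := by
  refine exists_detects_of_pow_eq_zero ?_ ?_ i₀ j₀
  · have : Ideal.Quotient.mk (I₂ p) ((p : Ku p) ^ 3) = 0 :=
      Ideal.Quotient.eq_zero_iff_mem.2 (Ideal.subset_span (by simp))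
    rwa [map_pow, map_natCast] at this
  · have : Ideal.Quotient.mk (I₂ p) (v p ^ (g p 1 + g p 2)) = 0 :=
      Ideal.Quotient.eq_zero_iff_mem.2 (Ideal.subset_span (Set.mem_insert_of_mem _ rfl))
    rwa [map_pow] at this

/-- The two conditions on `c` are those imposed by the functionals of `exists_detects_I₁` and
`exists_detects_I₂` when `c [i₀, j₀]` is the leading term of a boundary. -/
theorem exists_eq_of_mem_I₁_of_sq_mul_mem_I₂ {c : Ku p} (h1 : c ∈ I₁ p)
    (h2 : (p : Ku p) ^ 2 * c ∈ I₂ p) :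
    ∃ x y z : Ku p, c = x * (p : Ku p) ^ 2 + y * (p * v p ^ g p 1) + z * v p ^ (g p 1 + g p 2) := by
  obtain ⟨x, y, hxy⟩ := Ideal.mem_span_pair.1 h1
  obtain ⟨x', y', hxy'⟩ := Ideal.mem_span_pair.1 h2
  have hp0 : (p : Ku p) ^ 2 ≠ 0 := pow_ne_zero 2 (natCast_prime_ne_zero p)
  -- `v ^ (g_1 + g_2) y'` is divisible by `p ^ 2`, hence so is `y'`
  have hy' : ∃ t, y' = (p : Ku p) ^ 2 * t := by
    obtain ⟨t, ht⟩ : (p : Ku p) ∣ y' := by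
      refine prime_dvd_of_dvd_v_pow_mul p (n := g p 1 + g p 2) ⟨p * c - p ^ 2 * x', ?_⟩
      linear_combination hxy'
    obtain ⟨t', ht'⟩ : (p : Ku p) ∣ t := by
      refine prime_dvd_of_dvd_v_pow_mul p (n := g p 1 + g p 2) ⟨c - p * x', ?_⟩
      refine mul_left_cancel₀ (natCast_prime_ne_zero p) ?_
      rw [ht] at hxy'
      linear_combination hxy'
    exact ⟨t', by rw [ht, ht']; ring⟩
  obtain ⟨t, rfl⟩ := hy'
  have hc : c = p * x' + t * v p ^ (g p 1 + g p 2) := by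
    refine mul_left_cancel₀ hp0 ?_
    linear_combination -hxy'
  obtain ⟨w, hw⟩ : (p : Ku p) ∣ y - t * v p ^ g p 2 := by
    refine prime_dvd_of_dvd_v_pow_mul p (n := g p 1) ⟨x' - x * p, ?_⟩
    rw [pow_add] at hc
    linear_combination hxy + hc
  refine ⟨x, w, t, ?_⟩
  rw [pow_add]
  linear_combination -hxy + v p ^ g p 1 * hw

end Coker

end KuSS

/-! ### Two-term spectral sequences -/

namespace TwoTermSS

variable {R C₁ C₀ : Type*} [CommRing R] [AddCommGroup C₁] [AddCommGroup C₀] [Module R C₁]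
  [Module R C₀] {d : C₁ →ₗ[R] C₀} {F₁ : ℤ → Submodule R C₁} {F₀ : ℤ → Submodule R C₀}

/-- The chain `y` of lower filtration accounts for the boundaries divided out in `E^r`. -/
theorem isClass₀_dr_mk {r s : ℤ} (z : Z d F₁ F₀ r s) {x : C₀} (hx : x ∈ F₀ (s - r)) {y : C₁}
    (hy : y ∈ F₁ (s - 1)) (hdy : d y ∈ F₀ (s - r)) (h : x - d z - d y ∈ F₀ (s - r - 1)) :
    IsClass₀ d F₁ F₀ r (s - r) (dr d F₁ F₀ r s (Submodule.Quotient.mk z)) x := by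
  refine ⟨hx, (Submodule.Quotient.eq _).2 ?_⟩
  refine Submodule.mem_sup.2 ⟨_, h, d y, ⟨y, ⟨?_, ?_⟩, rfl⟩, ?_⟩
  · rwa [show s - r + r - 1 = s - 1 by ring]
  · change d y ∈ F₀ (s - r + r - 1 - (r - 1))
    rwa [show s - r + r - 1 - (r - 1) = s - r by ring]
  · exact sub_add_cancel _ _

theorem exists_of_dr_mk_eq_zero {r s : ℤ} (z : Z d F₁ F₀ r s)
    (h : dr d F₁ F₀ r s (Submodule.Quotient.mk z) = 0) :
    ∃ y ∈ F₁ (s - 1), d y ∈ F₀ (s - r) ∧ d z - d y ∈ F₀ (s - r - 1) := by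
  have h0 : (Submodule.Quotient.mk ⟨d z, z.2.2⟩ : E₀ d F₁ F₀ r (s - r)) = 0 := h
  have h' : d z ∈ F₀ (s - r - 1) ⊔ (Z d F₁ F₀ (r - 1) (s - r + r - 1)).map d :=
    (Submodule.Quotient.mk_eq_zero (Submodule.comap (F₀ (s - r)).subtype _)).1 h0
  obtain ⟨x, hx, _, ⟨y, ⟨hy1, hy2⟩, rfl⟩, hxy⟩ := Submodule.mem_sup.1 h'
  rw [show s - r + r - 1 = s - 1 by ring] at hy1
  rw [Submodule.comap_coe, Set.mem_preimage, SetLike.mem_coe,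
    show s - r + r - 1 - (r - 1) = s - r by ring] at hy2
  exact ⟨y, hy1, hy2, by rwa [← hxy, add_sub_cancel_right]⟩

theorem dr_mk_eq_zero {r s : ℤ} (z : Z d F₁ F₀ r s) {y : C₁}
    (hy : y ∈ F₁ (s - 1)) (hdy : d y ∈ F₀ (s - r)) (h : d z - d y ∈ F₀ (s - r - 1)) :
    dr d F₁ F₀ r s (Submodule.Quotient.mk z) = 0 := by
  obtain ⟨h0, h1⟩ := isClass₀_dr_mk (y := -y) z (zero_mem _) (neg_mem hy)
    (by rw [map_neg]; exact neg_mem hdy) (by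
      have := neg_mem h
      rw [neg_sub] at this
      rw [map_neg, zero_sub, sub_neg_eq_add, neg_add_eq_sub]
      exact this)
  rw [← h1]
  exact (Submodule.Quotient.mk_eq_zero _).2 (zero_mem _)

end TwoTermSS

namespace KuSS

/-! ### Leading terms of cycles and of boundaries -/

section Leading

variable {p : ℕ} [hp : Fact p.Prime]

theorem exists_sum_of_mem_filt {s : ℤ} {z : M p 2} (hz : z ∈ filt p 2 2 s) :
    ∃ c : ℕ+ × ℕ+ →₀ Ku p, (∀ q ∈ c.support, wt p 2 q.1 q.2 ≤ s) ∧
      z = ∑ q ∈ c.support, c q • br p 2 q.1 q.2 := by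
  have hset : {x | ∃ i j : ℕ+, wt p 2 i j ≤ s ∧ x = br p 2 i j} =
      (fun q : ℕ+ × ℕ+ => br p 2 q.1 q.2) '' {q | wt p 2 q.1 q.2 ≤ s} := by
    ext x
    constructor
    · rintro ⟨i, j, h, rfl⟩; exact ⟨(i, j), h, rfl⟩
    · rintro ⟨⟨i, j⟩, h, rfl⟩; exact ⟨i, j, h, rfl⟩
  rw [filt, hset] at hz
  obtain ⟨c, hc, rfl⟩ := (Finsupp.mem_span_image_iff_linearCombination (Ku p)).1 hz
  exact ⟨c, fun q hq => (Finsupp.mem_supported _ _).1 hc hq, rfl⟩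

/-- To show that `z` of filtration `s` lies in a submodule containing all elements of lower
filtration, it suffices to treat the leading terms `c [i, j]` of `z`. The coefficient `c` can be
read off from any functional that vanishes on the other generators of filtration at most `s`. -/
theorem mem_of_leading {s : ℤ} {z : M p 2} (hz : z ∈ filt p 2 2 s) {W : Submodule (Ku p) (M p 2)}
    (hW : filt p 2 2 (s - 1) ≤ W)
    (h : ∀ i j : ℕ+, wt p 2 i j = s → ∀ c : Ku p,
      (∀ {N : Type} [AddCommGroup N] [Module (Ku p) N] (ψ : M p 2 →ₗ[Ku p] N),
        (∀ i' j' : ℕ+, wt p 2 i' j' ≤ s → ¬ (i' = i ∧ j' = j) → ψ (br p 2 i' j') = 0) →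
        ψ z = c • ψ (br p 2 i j)) → c • br p 2 i j ∈ W) : z ∈ W := by
  obtain ⟨c, hc, hzc⟩ := exists_sum_of_mem_filt hz
  rw [hzc]
  refine Submodule.sum_mem _ fun q hq => ?_
  rcases (hc q hq).lt_or_eq with h1 | h1
  · exact hW (smul_br_mem_filt _ (by omega))
  · refine h q.1 q.2 h1 (c q) fun ψ hψ => ?_
    rw [hzc, map_sum, Finset.sum_eq_single q]
    · rw [map_smul]
    · intro q' hq' hne
      rw [map_smul, hψ _ _ (hc q' hq') (fun h2 => hne (Prod.ext h2.1 h2.2)), smul_zero]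
    · exact fun h2 => absurd hq h2

theorem Detects.eq_zero_of_wt_le {N : Type*} [AddCommGroup N] [Module (Ku p) N]
    {φ : M p 2 →ₗ[Ku p] N} {i₀ j₀ i j : ℕ+} (hφ : Detects φ i₀ j₀)
    (h : wt p 2 i j ≤ wt p 2 i₀ j₀) (hne : ¬ (i = i₀ ∧ j = j₀)) : φ (br p 2 i j) = 0 :=
  hφ _ _ (lt_or_lt_of_wt_le h fun h' => hne
    ⟨PNat.coe_injective (by exact_mod_cast h'.1), PNat.coe_injective (by exact_mod_cast h'.2)⟩)

theorem not_prime_dvd_cc_mul (n : ℕ) : ¬ (p : Ku p) ∣ cc p * v p ^ n := fun h =>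
  prime_not_dvd_v_pow p n ((isUnit_cc.dvd_mul_left).1 h)

theorem μ₁_lt_μ₂ : (μ₁ p : ℤ) < μ₂ p := by
  have hp2 := two_le_coe (p := p)
  rw [coe_μ₁, coe_μ₂]; nlinarith

theorem μ₁_pos : (0 : ℤ) < μ₁ p := by
  have hp2 := two_le_coe (p := p)
  rw [coe_μ₁]; nlinarith

theorem wt_sub_g_one (i j : ℤ) : wt p 2 i (j - g p 1) = wt p 2 i j - μ₁ p := by
  rw [wt_sub_right, coe_g_one, coe_μ₁]; ring

theorem wt_sub_g_one_g_two (i j : ℤ) :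
    wt p 2 (i - g p 1) (j - g p 2) = wt p 2 i j - μ₂ p := by
  rw [wt_sub_left, wt_sub_right, coe_g_one, coe_g_two, coe_μ₂]; ring

variable (p) in
/-- The span of the elements of filtration `s` with leading term `p [i, j]`, or `[i, j]` with
`j ≤ g_1`, whose boundaries have filtration at most `s - μ_2`. -/
noncomputable def U (s : ℤ) : Submodule (Ku p) (M p 2) :=
  Submodule.span (Ku p) {x | ∃ i j : ℕ+, wt p 2 i j = s ∧
    bd p 2 2 x ∈ filt p 2 2 (s - μ₂ p) ∧
    (x - (p : Ku p) • br p 2 i j ∈ filt p 2 2 (s - 1) ∨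
      ((j : ℕ) ≤ g p 1 ∧ x - br p 2 i j ∈ filt p 2 2 (s - 1)))}

theorem U_le_filt (s : ℤ) : U p s ≤ filt p 2 2 s := by
  refine Submodule.span_le.2 ?_
  rintro x ⟨i, j, hs, -, h | ⟨-, h⟩⟩
  · have := add_mem (filt_mono (by omega) h) (smul_br_mem_filt (p : Ku p) hs.le)
    rwa [sub_add_cancel] at this
  · have := add_mem (filt_mono (by omega) h) (br_mem_filt hs.le)
    rwa [sub_add_cancel] at this

theorem bd_mem_filt_of_mem_U {s : ℤ} {x : M p 2} (hx : x ∈ U p s) :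
    bd p 2 2 x ∈ filt p 2 2 (s - μ₂ p) := by
  refine (Submodule.span_le (p := (filt p 2 2 (s - μ₂ p)).comap (bd p 2 2))).2 ?_ hx
  rintro x ⟨i, j, hs, h, -⟩
  exact h

/-- An element whose boundary drops by more than `μ_1` has leading coefficients divisible by `p`,
except at the `[i, j]` with `j ≤ g_1`. -/
theorem mem_U_sup_filt {s : ℤ} {z : M p 2} (hz : z ∈ filt p 2 2 s)
    (hb : bd p 2 2 z ∈ filt p 2 2 (s - μ₁ p - 1)) : z ∈ U p s ⊔ filt p 2 2 (s - 1) := by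
  refine mem_of_leading hz le_sup_right fun i j hs c hc => ?_
  rcases le_or_gt (j : ℕ) (g p 1) with hj | hj
  · obtain ⟨B, hB1, hB2⟩ := exists_lift_br (p := p) i j (by exact_mod_cast hj)
    rw [hs] at hB1 hB2
    refine Submodule.smul_mem _ _ ?_
    rw [← sub_sub_cancel B (br p 2 i j)]
    refine sub_mem (Submodule.mem_sup_left (Submodule.subset_span
      ⟨i, j, hs, filt_mono (by omega) hB2, Or.inr ⟨hj, hB1⟩⟩)) (Submodule.mem_sup_right hB1)
  · obtain ⟨j', hj'⟩ := exists_pnat_eq (i := (j : ℤ) - g p 1) (by omega)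
    have hwt : wt p 2 i j' = s - μ₁ p := by rw [hj', wt_sub_g_one, hs]
    have hφ := detects_coord (p := p) i j'
    have hlead : ∀ i₁ j₁ : ℕ+, wt p 2 i₁ j₁ ≤ s → coord p i j' (bd p 2 2 (br p 2 i₁ j₁)) =
        -(((cc p : Ku p) * (p * v p ^ g p 1)) • coord p i j' (br p 2 i₁ (j₁ - g p 1))) := by
      intro i₁ j₁ h1
      have h2 := hφ.eq_zero_of_mem_filt (by omega) (bd_br_add_mem_filt (p := p) i₁ j₁)
      rw [map_add, map_smul] at h2
      exact eq_neg_of_add_eq_zero_left h2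
    have h1 := hc (coord p i j' ∘ₗ bd p 2 2) (fun i₁ j₁ h1 hne => by
      rw [LinearMap.comp_apply, hlead i₁ j₁ h1, hφ, smul_zero, neg_zero]
      rw [hj']
      have := lt_or_lt_of_wt_le (hs ▸ h1 : wt p 2 i₁ j₁ ≤ wt p 2 i j) (fun h' => hne
        ⟨PNat.coe_injective (by exact_mod_cast h'.1), PNat.coe_injective (by exact_mod_cast h'.2)⟩)
      omega)
    rw [LinearMap.comp_apply, LinearMap.comp_apply, hlead i j hs.le, ← hj', smul_neg, smul_smul,
      hφ.eq_zero_of_mem_filt (by omega) hb, eq_comm, neg_eq_zero, smul_coord_br_eq_zero_iff] at h1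
    obtain ⟨x, hx⟩ := h1
    obtain ⟨d, rfl⟩ : (p : Ku p) ∣ c := by
      refine prime_dvd_of_dvd_v_pow_mul p (n := g p 1)
        ((isUnit_cc.dvd_mul_left).1 ⟨x, mul_left_cancel₀ (natCast_prime_ne_zero p) ?_⟩)
      linear_combination hx
    obtain ⟨A, hA1, hA2⟩ := exists_lift_p_smul_br (p := p) i j
    rw [hs] at hA1 hA2
    have hbA : bd p 2 2 A ∈ filt p 2 2 (s - μ₂ p) :=
      (add_mem_cancel_right (smul_br_mem_filt _ (by rw [wt_sub_g_one_g_two, hs]))).1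
        (filt_mono (by omega) hA2)
    rw [mul_comm, mul_smul]
    refine Submodule.smul_mem _ _ ?_
    rw [← sub_sub_cancel A ((p : Ku p) • br p 2 i j)]
    exact sub_mem (Submodule.mem_sup_left (Submodule.subset_span ⟨i, j, hs, hbA, Or.inl hA1⟩))
      (Submodule.mem_sup_right hA1)

/-- Boundaries of chains at most `μ_2 - 1` above them in filtration have leading coefficients
divisible by `p v ^ g_1`, that is, they are accounted for by the first family. -/
theorem exists_bd_sub_smul_mem_filt {s : ℤ} {z : M p 2} (m : ℕ) (hm : (m : ℤ) < μ₂ p)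
    (hz : z ∈ filt p 2 2 (s + m)) (hb : bd p 2 2 z ∈ filt p 2 2 s) :
    ∃ y ∈ filt p 2 2 s, bd p 2 2 z - ((p : Ku p) * v p ^ g p 1) • y ∈ filt p 2 2 (s - 1) := by
  induction m generalizing z with
  | zero =>
    refine ⟨0, zero_mem _, ?_⟩
    rw [smul_zero, sub_zero]
    have := μ₁_pos (p := p)
    exact filt_mono (by push_cast; omega) (bd_mem_filt hz)
  | succ m ih =>
  rcases lt_or_ge (m + 1 : ℤ) (μ₁ p + 1) with h1 | h1
  · clear hb
    rw [filt] at hz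
    induction hz using Submodule.span_induction with
    | mem x hx =>
      obtain ⟨i, j, h, rfl⟩ := hx
      push_cast at h
      refine ⟨-((cc p : Ku p) • br p 2 i (j - g p 1)), neg_mem (smul_br_mem_filt _ ?_), ?_⟩
      · rw [wt_sub_g_one]; omega
      · rw [smul_neg, sub_neg_eq_add, smul_smul, mul_comm]
        exact filt_mono (by omega) (bd_br_add_mem_filt (p := p) i j)
    | zero => exact ⟨0, zero_mem _, by rw [map_zero, smul_zero, sub_zero]; exact zero_mem _⟩
    | add x₁ x₂ _ _ h₁ h₂ =>
      obtain ⟨y₁, hy₁, h₁⟩ := h₁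
      obtain ⟨y₂, hy₂, h₂⟩ := h₂
      refine ⟨y₁ + y₂, add_mem hy₁ hy₂, ?_⟩
      rw [map_add, smul_add, add_sub_add_comm]
      exact add_mem h₁ h₂
    | smul c x _ h =>
      obtain ⟨y, hy, h⟩ := h
      refine ⟨c • y, Submodule.smul_mem _ _ hy, ?_⟩
      rw [map_smul, smul_comm _ c, ← smul_sub]
      exact Submodule.smul_mem _ _ h
  · obtain ⟨u, hu, z', hz', rfl⟩ := Submodule.mem_sup.1
      (mem_U_sup_filt hz (filt_mono (by push_cast; omega) hb))
    have hbu := bd_mem_filt_of_mem_U hu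
    push_cast at hbu hz' hm
    rw [map_add] at hb ⊢
    obtain ⟨y, hy, h⟩ := ih (z := z') (by omega) (filt_mono (by omega) hz')
      ((add_mem_cancel_left (filt_mono (by omega) hbu)).1 hb)
    refine ⟨y, hy, ?_⟩
    rw [add_sub_assoc]
    exact add_mem (filt_mono (by omega) hbu) h

/-- Every boundary of filtration `t` is, up to lower filtration, the boundary of a chain of
filtration at most `t + μ_2`, since its leading coefficients lie in the ideal
`(p ^ 2, p v ^ g_1, v ^ (g_1 + g_2))`. -/
theorem exists_bd_sub_bd_mem_filt {t : ℤ} {z : M p 2} (hb : bd p 2 2 z ∈ filt p 2 2 t) :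
    ∃ y ∈ filt p 2 2 (t + μ₂ p), bd p 2 2 z - bd p 2 2 y ∈ filt p 2 2 (t - 1) := by
  have hlt := μ₁_lt_μ₂ (p := p)
  suffices h : bd p 2 2 z ∈ filt p 2 2 (t - 1) ⊔ (filt p 2 2 (t + μ₂ p)).map (bd p 2 2) by
    obtain ⟨x, hx, _, ⟨y, hy, rfl⟩, hxy⟩ := Submodule.mem_sup.1 h
    exact ⟨y, hy, by rwa [← hxy, add_sub_cancel_right]⟩
  refine mem_of_leading hb le_sup_left fun i j hs c hc => ?_
  set W := filt p 2 2 (t - 1) ⊔ (filt p 2 2 (t + μ₂ p)).map (bd p 2 2) with hW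
  have hc1 : c ∈ I₁ p := by
    obtain ⟨φ, h1, h2, h3⟩ := exists_detects_I₁ (p := p) i j
    have h4 := hc φ fun i' j' h hne => h1.eq_zero_of_wt_le (h.trans hs.ge) hne
    rw [h2, h3, Algebra.smul_def, mul_one] at h4
    exact Ideal.Quotient.eq_zero_iff_mem.1 h4.symm
  have hc2 : (p : Ku p) ^ 2 * c ∈ I₂ p := by
    obtain ⟨φ, h1, h2, h3⟩ := exists_detects_I₂ (p := p) i j
    have h4 := hc φ fun i' j' h hne => h1.eq_zero_of_wt_le (h.trans hs.ge) hne
    rw [h2, h3, Algebra.smul_def] at h4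
    refine Ideal.Quotient.eq_zero_iff_mem.1 ?_
    rw [map_mul, mul_comm, map_pow, map_natCast]
    exact h4.symm
  obtain ⟨x, y, w, rfl⟩ := exists_eq_of_mem_I₁_of_sq_mul_mem_I₂ hc1 hc2
  have e1 : (p : Ku p) ^ 2 • br p 2 i j ∈ W := by
    have hp2 := two_le_coe (p := p)
    have hm := μ₁_pos (p := p)
    refine Submodule.mem_sup_left
      ((sup_le ?_ ?_ : Err p (i + j) (wt p 2 i j) ≤ _) (sq_smul_br_mem_Err (p := p) i j))
    · exact (V_le_filt _ _ _).trans (filt_mono (by omega))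
    · refine (V_le_filt _ _ _).trans (filt_mono ?_)
      rw [hs, coe_g_two]
      nlinarith
  have e2 : ((p : Ku p) * v p ^ g p 1) • br p 2 i j ∈ W := by
    have h1 := bd_br_add_mem_filt (p := p) i (j + g p 1)
    rw [add_sub_cancel_right, mul_smul] at h1
    have h2 : wt p 2 i (j + g p 1) = t + μ₁ p := by
      rw [← hs, wt_add_right, coe_g_one, coe_μ₁]; ring
    rw [h2] at h1
    refine (Submodule.smul_mem_iff_of_isUnit W isUnit_cc).1 ((add_mem_cancel_left ?_).1
      (Submodule.mem_sup_left (filt_mono (by omega) h1)))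
    exact Submodule.mem_sup_right ⟨_, br_mem_filt (by omega), rfl⟩
  have e3 : v p ^ (g p 1 + g p 2) • br p 2 i j ∈ W := by
    obtain ⟨A, hA1, hA2⟩ := exists_lift_p_smul_br (p := p) (i + g p 1) (j + g p 2)
    have h2 : wt p 2 (i + g p 1) (j + g p 2) = t + μ₂ p := by
      have := wt_sub_g_one_g_two (p := p) (i + g p 1) (j + g p 2)
      rw [add_sub_cancel_right, add_sub_cancel_right, hs] at this
      omega
    rw [h2] at hA1 hA2
    simp only [add_sub_cancel_right, mul_smul] at hA2
    refine (Submodule.smul_mem_iff_of_isUnit W isUnit_cc).1 ((add_mem_cancel_left ?_).1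
      (Submodule.mem_sup_left hA2))
    refine Submodule.mem_sup_right ⟨A, ?_, rfl⟩
    have := add_mem (filt_mono (s' := t + μ₂ p) (by omega) hA1)
      (smul_br_mem_filt (p : Ku p) h2.le)
    rwa [sub_add_cancel] at this
  rw [add_smul, add_smul, mul_smul x, mul_smul y, mul_smul w]
  exact add_mem (add_mem (Submodule.smul_mem _ _ e1) (Submodule.smul_mem _ _ e2))
    (Submodule.smul_mem _ _ e3)

end Leading

end KuSS

namespace KuSS

/-! ### The pages and their differentials -/

section Pages

variable {p : ℕ} [hp : Fact p.Prime]

theorem dr_eq_zero_of_lt_μ₁ {r : ℤ} (hr : r < μ₁ p) (s : ℤ) : dr p 2 2 r s = 0 := by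
  refine LinearMap.ext fun ξ => ?_
  obtain ⟨z, rfl⟩ := Submodule.Quotient.mk_surjective _ ξ
  refine TwoTermSS.dr_mk_eq_zero z (y := 0) (zero_mem _) (by rw [map_zero]; exact zero_mem _) ?_
  rw [map_zero, sub_zero]
  exact filt_mono (by omega) (bd_mem_filt z.2.1)

/-- Between `μ_1` and `μ_2` a cycle is, up to a chain of lower filtration, an element of `U`, whose
boundary already lies `μ_2` below. -/
theorem dr_eq_zero_of_lt_of_lt {r : ℤ} (h1 : μ₁ p < r) (h2 : r < μ₂ p) (s : ℤ) :
    dr p 2 2 r s = 0 := by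
  refine LinearMap.ext fun ξ => ?_
  obtain ⟨⟨z, hz1, hz2⟩, rfl⟩ := Submodule.Quotient.mk_surjective _ ξ
  rw [Submodule.comap_coe, Set.mem_preimage, SetLike.mem_coe] at hz2
  obtain ⟨u, hu, z', hz', rfl⟩ := Submodule.mem_sup.1
    (mem_U_sup_filt hz1 (filt_mono (by omega) hz2))
  have hbu := bd_mem_filt_of_mem_U hu
  rw [map_add] at hz2
  refine TwoTermSS.dr_mk_eq_zero _ (y := z') hz'
    ((add_mem_cancel_left (filt_mono (by omega) hbu)).1 hz2) ?_
  rw [map_add, add_sub_cancel_right]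
  exact filt_mono (by omega) hbu

/-- Beyond `μ_2` the leading term of a boundary is already the leading term of the boundary of a
chain of lower filtration. -/
theorem dr_eq_zero_of_μ₂_lt {r : ℤ} (h : μ₂ p < r) (s : ℤ) : dr p 2 2 r s = 0 := by
  refine LinearMap.ext fun ξ => ?_
  obtain ⟨⟨z, hz1, hz2⟩, rfl⟩ := Submodule.Quotient.mk_surjective _ ξ
  rw [Submodule.comap_coe, Set.mem_preimage, SetLike.mem_coe] at hz2
  obtain ⟨y, hy, hzy⟩ := exists_bd_sub_bd_mem_filt hz2
  refine TwoTermSS.dr_mk_eq_zero _ (y := y) (filt_mono (by omega) hy) ?_ hzy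
  have := sub_mem hz2 (filt_mono (by omega) hzy)
  rwa [sub_sub_cancel] at this

theorem exists_isClass₁ {r s : ℤ} {z x : M p 2} (hx : x ∈ filt p 2 2 s)
    (hzx : z - x ∈ filt p 2 2 (s - 1)) (hz : bd p 2 2 z ∈ filt p 2 2 (s - r)) :
    ∃ ξ, IsClass₁ p 2 2 r s ξ x := by
  refine ⟨Submodule.Quotient.mk ⟨z, ?_, hz⟩, _, hzx, rfl⟩
  have := add_mem (filt_mono (by omega) hzx) hx
  rwa [sub_add_cancel] at this

theorem bd_br_mem_filt (i j : ℤ) : bd p 2 2 (br p 2 i j) ∈ filt p 2 2 (wt p 2 i j - μ₁ p) :=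
  bd_mem_filt (br_mem_filt le_rfl)

theorem isClass₀_dr_μ₁ {i j : ℤ}
    (ξ : E₁ p 2 2 (μ₁ p) (wt p 2 i j)) (hξ : IsClass₁ p 2 2 (μ₁ p) (wt p 2 i j) ξ (br p 2 i j)) :
    IsClass₀ p 2 2 (μ₁ p) (wt p 2 i j - μ₁ p) (dr p 2 2 (μ₁ p) (wt p 2 i j) ξ)
      ((-(cc p : Ku p) * p * v p ^ g p 1) • br p 2 i (j - g p 1)) := by
  obtain ⟨z, hz, rfl⟩ := hξ
  refine TwoTermSS.isClass₀_dr_mk z (y := 0) (smul_br_mem_filt _ (wt_sub_g_one i j).le)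
    (zero_mem _) (by rw [map_zero]; exact zero_mem _) ?_
  have h1 := bd_br_add_mem_filt (p := p) i j
  have h2 := filt_mono (by omega : wt p 2 i j - 1 - μ₁ p ≤ wt p 2 i j - μ₁ p - 1) (bd_mem_filt hz)
  have h3 := neg_mem (add_mem h1 h2)
  rw [map_sub] at h3
  rw [map_zero, sub_zero, neg_mul, neg_mul, neg_smul, mul_assoc]
  convert h3 using 1
  abel

theorem dr_μ₁_ne_zero {i j : ℕ+} (hj : g p 1 < (j : ℕ))
    (ξ : E₁ p 2 2 (μ₁ p) (wt p 2 i j)) (hξ : IsClass₁ p 2 2 (μ₁ p) (wt p 2 i j) ξ (br p 2 i j)) :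
    dr p 2 2 (μ₁ p) (wt p 2 i j) ξ ≠ 0 := by
  obtain ⟨z, hz, rfl⟩ := hξ
  intro h0
  obtain ⟨y, hy, -, h⟩ := TwoTermSS.exists_of_dr_mk_eq_zero z h0
  obtain ⟨j', hj'⟩ := exists_pnat_eq (i := (j : ℤ) - g p 1) (by omega)
  have hwt : wt p 2 i j' = wt p 2 i j - μ₁ p := by rw [hj', wt_sub_g_one]
  have hφ := detects_coord (p := p) i j'
  have e1 := hφ.eq_zero_of_mem_filt (by omega) h
  have e2 := hφ.eq_zero_of_mem_filt (by omega) (bd_br_add_mem_filt (p := p) i j)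
  have e3 := hφ.eq_zero_of_mem_filt (by omega) (bd_mem_filt hz)
  have e4 := hφ.eq_zero_of_mem_filt (by omega) (bd_mem_filt hy)
  rw [map_sub, e4, sub_zero] at e1
  rw [map_sub, map_sub, e1, zero_sub, neg_eq_zero] at e3
  rw [map_add, e3, zero_add, map_smul, ← hj', smul_coord_br_eq_zero_iff] at e2
  obtain ⟨x, hx⟩ := e2
  refine not_prime_dvd_cc_mul (p := p) (g p 1)
    ⟨x, mul_left_cancel₀ (natCast_prime_ne_zero p) ?_⟩
  linear_combination hx

theorem isClass₀_dr_μ₂ {i j : ℤ} (ξ : E₁ p 2 2 (μ₂ p) (wt p 2 i j))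
    (hξ : IsClass₁ p 2 2 (μ₂ p) (wt p 2 i j) ξ ((p : Ku p) • br p 2 i j)) :
    IsClass₀ p 2 2 (μ₂ p) (wt p 2 i j - μ₂ p) (dr p 2 2 (μ₂ p) (wt p 2 i j) ξ)
      ((-(cc p : Ku p) * v p ^ (g p 1 + g p 2)) • br p 2 (i - g p 1) (j - g p 2)) := by
  obtain ⟨z, hz, rfl⟩ := hξ
  obtain ⟨A, hA1, hA2⟩ := exists_lift_p_smul_br (p := p) i j
  have hx : ∀ c : Ku p, c • br p 2 (i - g p 1) (j - g p 2) ∈ filt p 2 2 (wt p 2 i j - μ₂ p) :=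
    fun c => smul_br_mem_filt _ (wt_sub_g_one_g_two i j).le
  have hbA : bd p 2 2 A ∈ filt p 2 2 (wt p 2 i j - μ₂ p) :=
    (add_mem_cancel_right (hx _)).1 (filt_mono (by omega) hA2)
  refine TwoTermSS.isClass₀_dr_mk z (y := A - z) (hx _) ?_ ?_ ?_
  · have := sub_mem hA1 hz
    rwa [sub_sub_sub_cancel_right] at this
  · rw [map_sub]
    exact sub_mem hbA z.2.2
  · have := neg_mem hA2
    rw [neg_mul, neg_smul, map_sub]
    convert this using 1
    abel

theorem dr_μ₂_ne_zero {i j : ℕ+} (hi : g p 1 < (i : ℕ)) (hj : g p 2 < (j : ℕ))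
    (ξ : E₁ p 2 2 (μ₂ p) (wt p 2 i j))
    (hξ : IsClass₁ p 2 2 (μ₂ p) (wt p 2 i j) ξ ((p : Ku p) • br p 2 i j)) :
    dr p 2 2 (μ₂ p) (wt p 2 i j) ξ ≠ 0 := by
  obtain ⟨z, hz, rfl⟩ := hξ
  intro h0
  obtain ⟨y, hy, hby, h⟩ := TwoTermSS.exists_of_dr_mk_eq_zero z h0
  obtain ⟨A, hA1, hA2⟩ := exists_lift_p_smul_br (p := p) i j
  obtain ⟨i', hi'⟩ := exists_pnat_eq (i := (i : ℤ) - g p 1) (by omega)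
  obtain ⟨j', hj'⟩ := exists_pnat_eq (i := (j : ℤ) - g p 2) (by omega)
  have hwt : wt p 2 i' j' = wt p 2 i j - μ₂ p := by rw [hi', hj', wt_sub_g_one_g_two]
  rw [← hi', ← hj'] at hA2
  have hbA : bd p 2 2 A ∈ filt p 2 2 (wt p 2 i j - μ₂ p) :=
    (add_mem_cancel_right (smul_br_mem_filt _ hwt.le)).1 (filt_mono (by omega) hA2)
  -- the chain `y + (A - z)` has lower filtration, and its boundary agrees with that of `A`, that is
  -- with `- c v ^ (g_1 + g_2) [i', j']`, up to lower terms
  have hm := μ₁_pos (p := p)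
  have hm' := μ₁_lt_μ₂ (p := p)
  have hy1 : y + (A - z) ∈ filt p 2 2 (wt p 2 i j - μ₂ p + ((μ₂ p - 1 : ℕ) : ℤ)) := by
    have := sub_mem hA1 hz
    rw [sub_sub_sub_cancel_right] at this
    exact filt_mono (by omega) (add_mem hy this)
  obtain ⟨x, hx, hx'⟩ := exists_bd_sub_smul_mem_filt (μ₂ p - 1) (by omega) hy1 (by
    rw [map_add, map_sub]
    exact add_mem hby (sub_mem hbA z.2.2))
  obtain ⟨c, hc⟩ : ∃ c : Ku p, coord p i' j' x = c • coord p i' j' (br p 2 i' j') := by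
    obtain ⟨c, hc, rfl⟩ := exists_sum_of_mem_filt hx
    refine ⟨c (i', j'), ?_⟩
    rw [map_sum, Finset.sum_eq_single (i', j'), map_smul]
    · intro q hq hne
      rw [map_smul, (detects_coord i' j').eq_zero_of_wt_le ((hc q hq).trans hwt.ge)
        (fun h2 => hne (Prod.ext h2.1 h2.2)), smul_zero]
    · intro hq
      rw [Finsupp.notMem_support_iff.1 hq, zero_smul, map_zero]
  have hφ := detects_coord (p := p) i' j'
  have e1 := hφ.eq_zero_of_mem_filt (by omega) h
  have e2 := hφ.eq_zero_of_mem_filt (by omega) hA2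
  have e3 := hφ.eq_zero_of_mem_filt (by omega) hx'
  rw [map_sub, sub_eq_zero] at e1
  rw [map_add, map_sub, map_sub, map_add, map_sub, e1, add_sub_cancel, map_smul, hc,
    sub_eq_zero] at e3
  rw [map_add, e3, map_smul, smul_smul, ← add_smul, smul_coord_br_eq_zero_iff] at e2
  obtain ⟨t, ht⟩ := e2
  refine not_prime_dvd_cc_mul (p := p) (g p 1 + g p 2) ⟨p * t - v p ^ g p 1 * c, ?_⟩
  linear_combination ht

theorem dr_μ₂_eq_zero {i j : ℤ} (hj : j ≤ g p 1) (ξ : E₁ p 2 2 (μ₂ p) (wt p 2 i j))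
    (hξ : IsClass₁ p 2 2 (μ₂ p) (wt p 2 i j) ξ (br p 2 i j)) :
    dr p 2 2 (μ₂ p) (wt p 2 i j) ξ = 0 := by
  obtain ⟨z, hz, rfl⟩ := hξ
  obtain ⟨B, hB1, hB2⟩ := exists_lift_br (p := p) i j hj
  refine TwoTermSS.dr_mk_eq_zero z (y := z - B) ?_ ?_ ?_
  · have := sub_mem hz hB1
    rwa [sub_sub_sub_cancel_right] at this
  · rw [map_sub]
    exact sub_mem z.2.2 (filt_mono (by omega) hB2)
  · rwa [map_sub, sub_sub_cancel]

/-- A page is generated by given classes as soon as every cycle is, up to lower filtration, a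
combination of cycles representing them. -/
theorem span_eq_top_of_forall_mem_sup {r s : ℤ} {G : Set (M p 2)} {X : Set (E₁ p 2 2 r s)}
    (hG : ∀ x ∈ G, ∃ hx : x ∈ TwoTermSS.Z (bd p 2 2) (filt p 2 2) (filt p 2 2) r s,
      (Submodule.Quotient.mk ⟨x, hx⟩ : E₁ p 2 2 r s) ∈ X)
    (h : ∀ z ∈ TwoTermSS.Z (bd p 2 2) (filt p 2 2) (filt p 2 2) r s,
      z ∈ Submodule.span (Ku p) G ⊔ filt p 2 2 (s - 1)) :
    Submodule.span (Ku p) X = ⊤ := by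
  refine eq_top_iff.2 fun ξ _ => ?_
  obtain ⟨⟨z, hz⟩, rfl⟩ := Submodule.Quotient.mk_surjective _ ξ
  obtain ⟨u, hu, z', hz', rfl⟩ := Submodule.mem_sup.1 (h z hz)
  have hspan : ∀ u ∈ Submodule.span (Ku p) G,
      ∃ hu : u ∈ TwoTermSS.Z (bd p 2 2) (filt p 2 2) (filt p 2 2) r s,
        (Submodule.Quotient.mk ⟨u, hu⟩ : E₁ p 2 2 r s) ∈ Submodule.span (Ku p) X := by
    intro u hu
    induction hu using Submodule.span_induction with
    | mem x hx =>
      obtain ⟨h1, h2⟩ := hG x hx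
      exact ⟨h1, Submodule.subset_span h2⟩
    | zero => exact ⟨zero_mem _, zero_mem _⟩
    | add x y _ _ hx hy =>
      obtain ⟨h1, h2⟩ := hx
      obtain ⟨h3, h4⟩ := hy
      exact ⟨add_mem h1 h3, add_mem h2 h4⟩
    | smul c x _ hx =>
      obtain ⟨h1, h2⟩ := hx
      exact ⟨Submodule.smul_mem _ _ h1, Submodule.smul_mem _ c h2⟩
  obtain ⟨hu1, hu2⟩ := hspan u hu
  have e : (Submodule.Quotient.mk ⟨u + z', hz⟩ : E₁ p 2 2 r s) =
      Submodule.Quotient.mk ⟨u, hu1⟩ := by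
    refine (Submodule.Quotient.eq _).2 ?_
    have h1 := sub_mem hz hu1
    rw [add_sub_cancel_left] at h1
    have h2 : u + z' - u ∈ TwoTermSS.Z (bd p 2 2) (filt p 2 2) (filt p 2 2) (r - 1) (s - 1) := by
      rw [add_sub_cancel_left]
      refine ⟨hz', ?_⟩
      rw [show s - 1 - (r - 1) = s - r by ring]
      exact h1.2
    exact h2
  rw [e]
  exact hu2

end Pages

end KuSS

theorem mainTheorem2 (p : ℕ) [Fact p.Prime] :
    ∃ u₁ u₂ : (KuSS.Ku p)ˣ,
      -- every differential of another length vanishes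
      (∀ r : ℕ, r ≠ KuSS.μ₁ p → r ≠ KuSS.μ₂ p → ∀ s : ℤ, KuSS.dr p 2 2 r s = 0) ∧
      -- the first family: `[i, j] ↦ p v ^ g_1 [i, j - g_1]`, up to a unit
      (∀ i j : ℕ+,
        (∃ ξ, KuSS.IsClass₁ p 2 2 (KuSS.μ₁ p) (KuSS.wt p 2 i j) ξ (KuSS.br p 2 i j)) ∧
        ∀ ξ, KuSS.IsClass₁ p 2 2 (KuSS.μ₁ p) (KuSS.wt p 2 i j) ξ (KuSS.br p 2 i j) →
          KuSS.IsClass₀ p 2 2 (KuSS.μ₁ p) (KuSS.wt p 2 i j - KuSS.μ₁ p)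
            (KuSS.dr p 2 2 (KuSS.μ₁ p) (KuSS.wt p 2 i j) ξ)
            (((u₁ : KuSS.Ku p) * (p : KuSS.Ku p) * KuSS.v p ^ KuSS.g p 1) •
              KuSS.br p 2 i (j - KuSS.g p 1)) ∧
          (KuSS.g p 1 < (j : ℕ) →
            KuSS.dr p 2 2 (KuSS.μ₁ p) (KuSS.wt p 2 i j) ξ ≠ 0)) ∧
      -- the classes `[i, j]` generate the page `E^{μ_1}` in degree `1`
      (∀ s : ℤ, Submodule.span (KuSS.Ku p)
        {ξ : KuSS.E₁ p 2 2 (KuSS.μ₁ p) s | ∃ i j : ℕ+, KuSS.wt p 2 i j = s ∧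
          KuSS.IsClass₁ p 2 2 (KuSS.μ₁ p) s ξ (KuSS.br p 2 i j)} = ⊤) ∧
      -- the second family: `p [i, j] ↦ v ^ (g_1 + g_2) [i - g_1, j - g_2]`, up to a unit
      (∀ i j : ℕ+,
        (∃ ξ, KuSS.IsClass₁ p 2 2 (KuSS.μ₂ p) (KuSS.wt p 2 i j) ξ
          ((p : KuSS.Ku p) • KuSS.br p 2 i j)) ∧
        ∀ ξ, KuSS.IsClass₁ p 2 2 (KuSS.μ₂ p) (KuSS.wt p 2 i j) ξ
            ((p : KuSS.Ku p) • KuSS.br p 2 i j) →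
          KuSS.IsClass₀ p 2 2 (KuSS.μ₂ p) (KuSS.wt p 2 i j - KuSS.μ₂ p)
            (KuSS.dr p 2 2 (KuSS.μ₂ p) (KuSS.wt p 2 i j) ξ)
            (((u₂ : KuSS.Ku p) * KuSS.v p ^ (KuSS.g p 1 + KuSS.g p 2)) •
              KuSS.br p 2 (i - KuSS.g p 1) (j - KuSS.g p 2)) ∧
          (KuSS.g p 1 < (i : ℕ) → KuSS.g p 2 < (j : ℕ) →
            KuSS.dr p 2 2 (KuSS.μ₂ p) (KuSS.wt p 2 i j) ξ ≠ 0)) ∧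
      -- the classes `[i, j]` with `j ≤ g_1`, on which `d_{μ_1}` vanishes, are also killed by
      -- `d_{μ_2}`
      (∀ i j : ℕ+, (j : ℕ) ≤ KuSS.g p 1 →
        (∃ ξ, KuSS.IsClass₁ p 2 2 (KuSS.μ₂ p) (KuSS.wt p 2 i j) ξ (KuSS.br p 2 i j)) ∧
        ∀ ξ, KuSS.IsClass₁ p 2 2 (KuSS.μ₂ p) (KuSS.wt p 2 i j) ξ (KuSS.br p 2 i j) →
          KuSS.dr p 2 2 (KuSS.μ₂ p) (KuSS.wt p 2 i j) ξ = 0) ∧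
      -- the classes `p [i, j]` and the `[i, j]` with `j ≤ g_1` generate the page `E^{μ_2}` in
      -- degree `1`
      (∀ s : ℤ, Submodule.span (KuSS.Ku p)
        {ξ : KuSS.E₁ p 2 2 (KuSS.μ₂ p) s | ∃ i j : ℕ+, KuSS.wt p 2 i j = s ∧
          (KuSS.IsClass₁ p 2 2 (KuSS.μ₂ p) s ξ ((p : KuSS.Ku p) • KuSS.br p 2 i j) ∨
            ((j : ℕ) ≤ KuSS.g p 1 ∧
              KuSS.IsClass₁ p 2 2 (KuSS.μ₂ p) s ξ (KuSS.br p 2 i j)))} = ⊤) := by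
  have hu : ((-KuSS.isUnit_cc.unit : (KuSS.Ku p)ˣ) : KuSS.Ku p) = -(KuSS.cc p : KuSS.Ku p) := by
    rw [Units.val_neg, IsUnit.unit_spec]
  have h12 := KuSS.μ₁_lt_μ₂ (p := p)
  refine ⟨-KuSS.isUnit_cc.unit, -KuSS.isUnit_cc.unit, fun r h1 h2 s => ?_, fun i j => ⟨?_, ?_⟩,
    fun s => ?_, fun i j => ⟨?_, ?_⟩, fun i j hj => ⟨?_, ?_⟩, fun s => ?_⟩
  · rcases lt_or_gt_of_ne h1 with h1 | h1
    · exact KuSS.dr_eq_zero_of_lt_μ₁ (by exact_mod_cast h1) s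
    rcases lt_or_gt_of_ne h2 with h2 | h2
    · exact KuSS.dr_eq_zero_of_lt_of_lt (by exact_mod_cast h1) (by exact_mod_cast h2) s
    · exact KuSS.dr_eq_zero_of_μ₂_lt (by exact_mod_cast h2) s
  · exact KuSS.exists_isClass₁ (KuSS.br_mem_filt le_rfl) (by rw [sub_self]; exact zero_mem _)
      (KuSS.bd_br_mem_filt _ _)
  · rw [hu]
    exact fun ξ hξ => ⟨KuSS.isClass₀_dr_μ₁ ξ hξ, fun hj => KuSS.dr_μ₁_ne_zero hj ξ hξ⟩
  · refine KuSS.span_eq_top_of_forall_mem_sup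
      (G := {x | ∃ i j : ℕ+, KuSS.wt p 2 i j = s ∧ x = KuSS.br p 2 i j}) ?_ ?_
    · rintro _ ⟨i, j, rfl, rfl⟩
      exact ⟨⟨KuSS.br_mem_filt le_rfl, KuSS.bd_br_mem_filt _ _⟩, i, j, rfl, _,
        by rw [sub_self]; exact zero_mem _, rfl⟩
    · refine fun z hz => KuSS.mem_of_leading hz.1 le_sup_right fun i j h c _ => ?_
      exact Submodule.mem_sup_left (Submodule.smul_mem _ _ (Submodule.subset_span ⟨i, j, h, rfl⟩))
  · obtain ⟨A, hA1, hA2⟩ := KuSS.exists_lift_p_smul_br (p := p) i j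
    refine KuSS.exists_isClass₁ (KuSS.smul_br_mem_filt _ le_rfl) hA1 ?_
    exact (add_mem_cancel_right (KuSS.smul_br_mem_filt _ (KuSS.wt_sub_g_one_g_two _ _).le)).1
      (KuSS.filt_mono (by omega) hA2)
  · rw [hu]
    exact fun ξ hξ => ⟨KuSS.isClass₀_dr_μ₂ ξ hξ, fun hi hj => KuSS.dr_μ₂_ne_zero hi hj ξ hξ⟩
  · obtain ⟨B, hB1, hB2⟩ := KuSS.exists_lift_br (p := p) i j (by exact_mod_cast hj)
    exact KuSS.exists_isClass₁ (KuSS.br_mem_filt le_rfl) hB1 (KuSS.filt_mono (by omega) hB2)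
  · exact fun ξ hξ => KuSS.dr_μ₂_eq_zero (by exact_mod_cast hj) ξ hξ
  · refine KuSS.span_eq_top_of_forall_mem_sup
      (G := {x | ∃ i j : ℕ+, KuSS.wt p 2 i j = s ∧
        KuSS.bd p 2 2 x ∈ KuSS.filt p 2 2 (s - KuSS.μ₂ p) ∧
        (x - (p : KuSS.Ku p) • KuSS.br p 2 i j ∈ KuSS.filt p 2 2 (s - 1) ∨
          ((j : ℕ) ≤ KuSS.g p 1 ∧ x - KuSS.br p 2 i j ∈ KuSS.filt p 2 2 (s - 1)))}) ?_ ?_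
    · intro x hx
      refine ⟨⟨KuSS.U_le_filt s (Submodule.subset_span hx), ?_⟩, ?_⟩
      · exact KuSS.bd_mem_filt_of_mem_U (Submodule.subset_span hx)
      · obtain ⟨i, j, h, -, hx | ⟨hj, hx⟩⟩ := hx
        · exact ⟨i, j, h, Or.inl ⟨_, hx, rfl⟩⟩
        · exact ⟨i, j, h, Or.inr ⟨hj, _, hx, rfl⟩⟩
    · exact fun z hz => KuSS.mem_U_sup_filt hz.1 (KuSS.filt_mono (by omega) hz.2)
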